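/- Let $\Bbbk$ be a field of positive characteristic and let $m\ge 2$ be an integer. For a $\Bbbk$-algebra $B$, a locally finite iterative higher derivation on $B$ is a $\Bbbk$-algebra homomorphism $\theta:B\to B[U]$, $\theta(b)=\sum_{n\ge 0}\theta^{(n)}(b)U^n$, such that $\theta^{(0)}=\mathrm{id}_B$ and $\theta^{(i)}(\theta^{(j)}(b))=\binom{i+j}{i}\theta^{(i+j)}(b)$ for all $i,j\ge 0$ and $b\in B$. Its ring of invariants is the $\Bbbk$-subalgebra $B^\theta=\{b\in B \mid \theta^{(n)}(b)=0 \text{ for all } n\ge 1\}$. Consider the following three locally finite iterative higher derivations on polynomial rings. (DF5-$m$) $B_5=\Bbbk[x,s,t,u,v]$ with $\theta(x)=x$, $\theta(s)=s+x^{m+1}U$, $\theta(t)=t+2sU+x^{m+1}U^2$, $\theta(u)=u+3tU+3sU^2+x^{m+1}U^3$, $\theta(v)=v+x^mU$. (F6-$m$) $B_6=\Bbbk[x,y,s,t,u,v]$ with $\theta(x)=x$, $\theta(y)=y$, $\theta(s)=s+x^{m+1}U$, $\theta(t)=t+2y^{m+1}sU+x^{m+1}y^{m+1}U^2$, $\theta(u)=u+3y^{m+1}tU+3y^{2(m+1)}sU^2+x^{m+1}y^{2(m+1)}U^3$,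 $\theta(v)=v+x^my^mU$. (R7-$m$) $B_7=\Bbbk[x_1,x_2,x_3,y_1,y_2,y_3,v]$ with $\theta(x_i)=x_i$, $\theta(y_i)=y_i+x_i^{m+1}U$ for $i=1,2,3$, and $\theta(v)=v+x_1^mx_2^mx_3^mU$. Then the rings of invariants $B_5^\theta$, $B_6^\theta$ and $B_7^\theta$ are finitely generated $\Bbbk$-algebras. -/

import Mathlib

/-- A locally finite iterative higher derivation on a `k`-algebra `B`: a `k`-algebra homomorphism
`θ : B → B[U]`, `θ(b) = ∑ θ⁽ⁿ⁾(b) Uⁿ`, with `θ⁽⁰⁾ = id` and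
`θ⁽ⁱ⁾ ∘ θ⁽ʲ⁾ = (i + j choose i) θ⁽ⁱ⁺ʲ⁾`. (That `θ` is a ring homomorphism with values in
polynomials is the Leibniz rule together with local finiteness.) -/
structure LFIHD (k B : Type*) [CommRing k] [CommRing B] [Algebra k B] where
  toAlgHom : B →ₐ[k] Polynomial B
  coeff_zero : ∀ b, (toAlgHom b).coeff 0 = b
  iterative : ∀ (i j : ℕ) (b : B),
    (toAlgHom ((toAlgHom b).coeff j)).coeff i = (i + j).choose i • (toAlgHom b).coeff (i + j)

namespace LFIHD

/-- The ring of invariants (ring of constants)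
`B^θ = {b ∈ B | θ⁽ⁿ⁾(b) = 0 for all n ≥ 1}`, a `k`-subalgebra of `B`. -/
def invariants {k B : Type*} [CommRing k] [CommRing B] [Algebra k B] (θ : LFIHD k B) :
    Subalgebra k B where
  carrier := {b | ∀ n, 1 ≤ n → (θ.toAlgHom b).coeff n = 0}
  mul_mem' := by
    intro a b ha hb n hn
    rw [map_mul, Polynomial.coeff_mul]
    refine Finset.sum_eq_zero fun ij hij => ?_
    have hsum : ij.1 + ij.2 = n := Finset.HasAntidiagonal.mem_antidiagonal.mp hij
    rcases Nat.eq_zero_or_pos ij.1 with h | h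
    · rw [hb ij.2 (by omega), mul_zero]
    · rw [ha ij.1 h, zero_mul]
  add_mem' := by
    intro a b ha hb n hn
    rw [map_add, Polynomial.coeff_add, ha n hn, hb n hn, add_zero]
  algebraMap_mem' := by
    intro r n hn
    rw [AlgHom.commutes, Polynomial.algebraMap_apply, Polynomial.coeff_C, if_neg (by omega)]

/-- On a polynomial ring, a homomorphism given by the images of the variables is a locally finite
iterative higher derivation as soon as the two conditions hold on the variables. The second one
says `θ_V (θ_U (X i)) = θ_{U + V} (X i)`, in `B[V][U]`. -/
noncomputable def ofVariables {k σ : Type*} [CommRing k]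
    (f : σ → Polynomial (MvPolynomial σ k))
    (h0 : ∀ i, (f i).coeff 0 = MvPolynomial.X i)
    (h1 : ∀ i, (f i).map (MvPolynomial.aeval f :
        MvPolynomial σ k →ₐ[k] Polynomial (MvPolynomial σ k)).toRingHom =
      Polynomial.taylor Polynomial.X ((f i).map Polynomial.C)) :
    LFIHD k (MvPolynomial σ k) where
  toAlgHom := MvPolynomial.aeval f
  coeff_zero := by
    intro b
    have h : (Polynomial.constantCoeff : Polynomial (MvPolynomial σ k) →+* _).comp
        (MvPolynomial.aeval f : MvPolynomial σ k →ₐ[k] _).toRingHom = RingHom.id _ := by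
      apply MvPolynomial.ringHom_ext
      · intro r
        simp [Polynomial.algebraMap_apply]
      · intro i
        simp [h0]
    exact RingHom.congr_fun h b
  iterative := by
    intro i j b
    have h : (Polynomial.mapAlgHom (MvPolynomial.aeval f :
          MvPolynomial σ k →ₐ[k] Polynomial (MvPolynomial σ k))).comp (MvPolynomial.aeval f) =
        (((Polynomial.taylorAlgHom
          (Polynomial.X : Polynomial (MvPolynomial σ k))).restrictScalars k).comp
          (Polynomial.mapAlgHom Polynomial.CAlgHom)).comp (MvPolynomial.aeval f) := by
      apply MvPolynomial.algHom_ext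
      intro i
      have := h1 i
      simp only [AlgHom.comp_apply, MvPolynomial.aeval_X]
      exact this
    have hb := congrArg (fun q => (Polynomial.coeff q j).coeff i) (AlgHom.congr_fun h b)
    have hl : ((Polynomial.taylor (Polynomial.X : Polynomial (MvPolynomial σ k))
        ((MvPolynomial.aeval f b).map Polynomial.C)).coeff j).coeff i =
        (i + j).choose i • (MvPolynomial.aeval f b).coeff (i + j) := by
      have hm : Polynomial.hasseDeriv j ((MvPolynomial.aeval f b).map Polynomial.C) =
          (Polynomial.hasseDeriv j (MvPolynomial.aeval f b)).map Polynomial.C := by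
        ext n : 1
        simp [Polynomial.hasseDeriv_coeff]
      rw [Polynomial.taylor_coeff, hm, Polynomial.eval_map, Polynomial.eval₂_C_X,
        Polynomial.hasseDeriv_coeff, nsmul_eq_mul, Nat.choose_symm_add]
    rw [← hl]
    have hr : ((Polynomial.map (MvPolynomial.aeval f :
          MvPolynomial σ k →ₐ[k] Polynomial (MvPolynomial σ k)).toRingHom
        (MvPolynomial.aeval f b)).coeff j).coeff i =
        (MvPolynomial.aeval f ((MvPolynomial.aeval f b).coeff j)).coeff i := by
      rw [Polynomial.coeff_map]
      rfl
    rw [← hr]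
    exact hb

end LFIHD

/-- The variables of `B₅ = k[x, s, t, u, v]`. -/
inductive Var5 : Type
  | x | s | t | u | v

/-- The variables of `B₆ = k[x, y, s, t, u, v]`. -/
inductive Var6 : Type
  | x | y | s | t | u | v

/-- The variables of `B₇ = k[x₁, x₂, x₃, y₁, y₂, y₃, v]`. -/
inductive Var7 : Type
  | x (i : Fin 3) | y (i : Fin 3) | v

section Examples

open Polynomial (C)

/-- Images of the variables in the generalized Daigle-Freudenburg example; `U` is the variable of
`B₅[U]`. -/
noncomputable def dfImage (k : Type*) [CommRing k] (m : ℕ) :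
    Var5 → Polynomial (MvPolynomial Var5 k) :=
  let x : MvPolynomial Var5 k := MvPolynomial.X .x
  let s : MvPolynomial Var5 k := MvPolynomial.X .s
  let t : MvPolynomial Var5 k := MvPolynomial.X .t
  let u : MvPolynomial Var5 k := MvPolynomial.X .u
  let v : MvPolynomial Var5 k := MvPolynomial.X .v
  let U : Polynomial (MvPolynomial Var5 k) := Polynomial.X
  fun
  | .x => C x
  | .s => C s + C (x ^ (m + 1)) * U
  | .t => C t + C (2 * s) * U + C (x ^ (m + 1)) * U ^ 2
  | .u => C u + C (3 * t) * U + C (3 * s) * U ^ 2 + C (x ^ (m + 1)) * U ^ 3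
  | .v => C v + C (x ^ m) * U

/-- Images of the variables in the generalized Freudenburg example. -/
noncomputable def fImage (k : Type*) [CommRing k] (m : ℕ) :
    Var6 → Polynomial (MvPolynomial Var6 k) :=
  let x : MvPolynomial Var6 k := MvPolynomial.X .x
  let y : MvPolynomial Var6 k := MvPolynomial.X .y
  let s : MvPolynomial Var6 k := MvPolynomial.X .s
  let t : MvPolynomial Var6 k := MvPolynomial.X .t
  let u : MvPolynomial Var6 k := MvPolynomial.X .u
  let v : MvPolynomial Var6 k := MvPolynomial.X .v
  let U : Polynomial (MvPolynomial Var6 k) := Polynomial.X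
  fun
  | .x => C x
  | .y => C y
  | .s => C s + C (x ^ (m + 1)) * U
  | .t => C t + C (2 * y ^ (m + 1) * s) * U + C (x ^ (m + 1) * y ^ (m + 1)) * U ^ 2
  | .u => C u + C (3 * y ^ (m + 1) * t) * U + C (3 * y ^ (2 * (m + 1)) * s) * U ^ 2
      + C (x ^ (m + 1) * y ^ (2 * (m + 1))) * U ^ 3
  | .v => C v + C (x ^ m * y ^ m) * U

/-- Images of the variables in the generalized Roberts example. -/
noncomputable def rImage (k : Type*) [CommRing k] (m : ℕ) :
    Var7 → Polynomial (MvPolynomial Var7 k) :=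
  let x : Fin 3 → MvPolynomial Var7 k := fun i => MvPolynomial.X (.x i)
  let y : Fin 3 → MvPolynomial Var7 k := fun i => MvPolynomial.X (.y i)
  let v : MvPolynomial Var7 k := MvPolynomial.X .v
  let U : Polynomial (MvPolynomial Var7 k) := Polynomial.X
  fun
  | .x i => C (x i)
  | .y i => C (y i) + C (x i ^ (m + 1)) * U
  | .v => C v + C (x 0 ^ m * x 1 ^ m * x 2 ^ m) * U

/-- The generalized Daigle-Freudenburg example (DF5-m). -/
noncomputable def DF5 (k : Type*) [CommRing k] (m : ℕ) : LFIHD k (MvPolynomial Var5 k) :=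
  LFIHD.ofVariables (dfImage k m)
    (by
      intro i
      cases i <;> simp [dfImage, Polynomial.coeff_X_pow, Polynomial.coeff_C])
    (by
      intro i
      cases i <;> simp [dfImage] <;> (try simp only [map_ofNat Polynomial.C]) <;> ring)

/-- The generalized Freudenburg example (F6-m). -/
noncomputable def F6 (k : Type*) [CommRing k] (m : ℕ) : LFIHD k (MvPolynomial Var6 k) :=
  LFIHD.ofVariables (fImage k m)
    (by
      intro i
      cases i <;> simp [fImage, Polynomial.coeff_X_pow, Polynomial.coeff_C])
    (by
      intro i
      cases i <;> simp [fImage] <;> (try simp only [map_ofNat Polynomial.C]) <;> ring)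

/-- The generalized Roberts example (R7-m). -/
noncomputable def R7 (k : Type*) [CommRing k] (m : ℕ) : LFIHD k (MvPolynomial Var7 k) :=
  LFIHD.ofVariables (rImage k m)
    (by
      intro i
      cases i <;> simp [rImage])
    (by
      intro i
      cases i <;> simp [rImage] <;> ring)

end Examples

/-!
Write `B = A[v]`, where `A` is the polynomial ring in the remaining variables. The derivation maps
`A` to itself and moves `v` to `v + τ U` with `τ ∈ A`. The leading coefficient in `v` of an
invariant is an invariant of `A`. If the invariants of `A` are finitely generated, hence Noetherian,
and some invariant of `B` is monic in `v` of positive degree, then the ideals of leading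
coefficients are stable from some degree on, and the invariants of `B` are finitely generated
(`Subalgebra.fg_of_monic`, `leadingCoeff_mem_fixedRing`).

The monic invariants exist because the characteristic `p` is positive. In both rings there is a
cubic `f(Z)` with coefficients in `A` which the derivation moves to `f(Z + U)`: the product of the
linear forms `x_i ^ (m + 1) Z + y_i`, and the cubic with coefficients `u`, `3 t`, `3 s`,
`x ^ (m + 1)` up to powers of `y`. Let `ℓ` be its leading coefficient. For `p = 3 r + 2` and
`N = 2 r + 1`, the polynomial `f ^ N` has degree `2 p - 1`; since `p` divides `(i choose p - 1)` for
`p ≤ i ≤ 2 p - 2`, its coefficient of `Z ^ (p - 1)` moves by `ℓ ^ N U ^ p` only. As `N ≤ 2 p / 3`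
and `m ≥ 2`, the power `τ ^ p` is divisible by `ℓ ^ N` (for the cubic, after division by the power
of `y` that the coefficient contains), so a multiple of this coefficient can be subtracted from
`v ^ p` to get an invariant. For `p = 3 r + 1` and `N = 2 r` the coefficient of `Z ^ (p - 1)` in
`f ^ N` is invariant, the coefficient of `Z ^ (p - 2)` moves by `ℓ ^ N U ^ p` minus `U` times the
former, and there is an invariant `v ^ p - a₁ v - a₀`. For `p = 3` there are explicit formulas.

The invariants of `A` are computed in a way that does not depend on the characteristic, except that
two is special for the cubic. Substitution of a local slice for `U` shows that the known invariants
generate all of them after inversion of one variable `x` (`fixedRing_le_of_slice`), and a normal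
form modulo `x` shows that the algebra `S` which they generate satisfies `S ∩ x A = x S`
(`mem_adjoin_of_mul_mem`).

Finally `B₅` is the specialization `y = 1` of `B₆`. This specialization has an equivariant section,
which multiplies the variables by powers of `y`, so the invariants of `B₆` map onto those of `B₅`.
-/

/-! ### Fixed rings of homomorphisms into a polynomial ring -/

section FixedRing

variable {k A B : Type*} [CommRing k] [CommRing A] [CommRing B] [Algebra k A] [Algebra k B]

/-- The subalgebra of all `a` that a homomorphism `θ : A → A[U]` sends to the constant
polynomial `a`. For a locally finite iterative higher derivation it is the ring of invariants;
none of the arguments about it needs the iteration rule. -/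
noncomputable def fixedRing (θ : A →ₐ[k] Polynomial A) : Subalgebra k A :=
  AlgHom.equalizer θ Polynomial.CAlgHom

theorem mem_fixedRing {θ : A →ₐ[k] Polynomial A} {a : A} :
    a ∈ fixedRing θ ↔ θ a = Polynomial.C a := Iff.rfl

theorem LFIHD.invariants_eq_fixedRing (θ : LFIHD k A) :
    θ.invariants = fixedRing θ.toAlgHom := by
  ext a
  rw [mem_fixedRing]
  constructor
  · intro h
    ext n
    rcases n with _ | n
    · rw [θ.coeff_zero, Polynomial.coeff_C_zero]
    · rw [h (n + 1) (by omega), Polynomial.coeff_C_succ]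
  · intro h n hn
    rw [h, Polynomial.coeff_C, if_neg (by omega)]

theorem map_mem_fixedRing {θ : A →ₐ[k] Polynomial A} {θ' : B →ₐ[k] Polynomial B} (e : A →ₐ[k] B)
    (h : θ'.comp e = (Polynomial.mapAlgHom e).comp θ) {a : A} (ha : a ∈ fixedRing θ) :
    e a ∈ fixedRing θ' := by
  rw [mem_fixedRing] at ha ⊢
  have := AlgHom.congr_fun h a
  simp only [AlgHom.comp_apply, ha, Polynomial.coe_mapAlgHom] at this
  simpa using this

/-- An equivariant homomorphism with an equivariant section maps the fixed ring onto the
fixed ring. -/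
theorem fixedRing_fg_of_retract {θ : A →ₐ[k] Polynomial A} {θ' : B →ₐ[k] Polynomial B}
    (e : A →ₐ[k] B) (h : θ'.comp e = (Polynomial.mapAlgHom e).comp θ)
    (j : B →ₐ[k] A) (hj : θ.comp j = (Polynomial.mapAlgHom j).comp θ')
    (hej : ∀ b, e (j b) = b) (hfg : (fixedRing θ).FG) : (fixedRing θ').FG := by
  have : fixedRing θ' = (fixedRing θ).map e := by
    apply le_antisymm
    · intro b hb
      exact ⟨j b, map_mem_fixedRing j hj hb, hej b⟩
    · rintro _ ⟨a, ha, rfl⟩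
      exact map_mem_fixedRing e h ha
  rw [this]
  exact hfg.map e

end FixedRing

/-! ### Subalgebras of a polynomial ring that contain a monic polynomial -/

section LeadingCoefficients

variable {k A : Type*} [Field k] [CommRing A] [Algebra k A]

/-- The ideal of those `c ∈ S₀` that occur as the coefficient of `X ^ d` in an element of `S` of
degree at most `d`. -/
def leadingIdeal (S : Subalgebra k (Polynomial A)) (S₀ : Subalgebra k A)
    (hC : ∀ c ∈ S₀, Polynomial.C c ∈ S) (d : ℕ) : Ideal S₀ where
  carrier := {c | ∃ f ∈ S, f.natDegree ≤ d ∧ f.coeff d = c}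
  add_mem' := by
    rintro a b ⟨f, hf, hfd, hfa⟩ ⟨g, hg, hgd, hgb⟩
    exact ⟨f + g, S.add_mem hf hg, Polynomial.natDegree_add_le_of_degree_le hfd hgd,
      by rw [Polynomial.coeff_add, hfa, hgb]; rfl⟩
  zero_mem' := ⟨0, S.zero_mem, by simp, by simp⟩
  smul_mem' := by
    rintro c a ⟨f, hf, hfd, hfa⟩
    exact ⟨Polynomial.C (c : A) * f, S.mul_mem (hC c c.2) hf,
      (Polynomial.natDegree_C_mul_le _ _).trans hfd, by rw [Polynomial.coeff_C_mul, hfa]; rfl⟩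

/-- Multiplication by the monic `F` gives `I d ≤ I (d + deg F)` for the ideals `I d` of leading
coefficients. In a Noetherian ring `S₀` these chains stop, so from some degree on every leading
coefficient is already the leading coefficient of a multiple of `F`. -/
theorem exists_leadingIdeal_le (S : Subalgebra k (Polynomial A)) (S₀ : Subalgebra k A)
    (hC : ∀ c ∈ S₀, Polynomial.C c ∈ S) [IsNoetherianRing S₀]
    {F : Polynomial A} (hF : F ∈ S) (hmon : F.Monic) (hpos : 0 < F.natDegree) :
    ∃ D, F.natDegree ≤ D ∧
      ∀ d, D ≤ d → leadingIdeal S S₀ hC d ≤ leadingIdeal S S₀ hC (d - F.natDegree) := by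
  set n := F.natDegree with hn
  have hstep : ∀ d, leadingIdeal S S₀ hC d ≤ leadingIdeal S S₀ hC (d + n) := by
    rintro d c ⟨f, hf, hfd, hfc⟩
    refine ⟨f * F, S.mul_mem hf hF, Polynomial.natDegree_mul_le_of_le hfd hn.ge, ?_⟩
    rw [Polynomial.coeff_mul_add_eq_of_natDegree_le hfd hn.ge, hfc, hn, hmon.coeff_natDegree, mul_one]
  have hmono : ∀ a, Monotone fun j => leadingIdeal S S₀ hC (a + j * n) := fun a =>
    monotone_nat_of_le_succ fun j => by
      have := hstep (a + j * n)
      rwa [show a + j * n + n = a + (j + 1) * n by ring] at this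
  have hstab : ∀ a, ∃ J, ∀ j, J ≤ j →
      leadingIdeal S S₀ hC (a + J * n) = leadingIdeal S S₀ hC (a + j * n) := fun a =>
    monotone_stabilizes_iff_noetherian.mpr inferInstance ⟨_, hmono a⟩
  choose J hJ using hstab
  refine ⟨n * (1 + ∑ a ∈ Finset.range n, J a), Nat.le_mul_of_pos_right _ (by omega), fun d hd => ?_⟩
  have hr : d % n < n := Nat.mod_lt _ hpos
  have hle : J (d % n) ≤ ∑ a ∈ Finset.range n, J a :=
    Finset.single_le_sum (f := J) (fun _ _ => Nat.zero_le _) (Finset.mem_range.mpr hr)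
  have hq : 1 + ∑ a ∈ Finset.range n, J a ≤ d / n := by
    rw [Nat.le_div_iff_mul_le hpos, mul_comm]
    exact hd
  have hdn : d % n + (d / n) * n = d := by rw [mul_comm]; exact Nat.mod_add_div d n
  obtain ⟨q, hq'⟩ : ∃ q, d / n = q + 1 := ⟨d / n - 1, by omega⟩
  have h1 := hJ (d % n) (q + 1) (by omega)
  have h2 := hJ (d % n) q (by omega)
  have h3 : d - n = d % n + q * n := by
    rw [hq'] at hdn
    have : (q + 1) * n = q * n + n := by ring
    omega
  rw [h3, ← h2, h1, ← hq', hdn]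

/-- Let `S₀` be a finitely generated algebra of constants of `S ⊆ A[X]` that contains all leading
coefficients of `S`. If `S` contains a monic polynomial of positive degree, then `S` is finitely
generated. -/
theorem Subalgebra.fg_of_monic (S : Subalgebra k (Polynomial A)) (S₀ : Subalgebra k A)
    (hfg : S₀.FG) (hC : ∀ c ∈ S₀, Polynomial.C c ∈ S)
    (hlc : ∀ f ∈ S, f.leadingCoeff ∈ S₀)
    {F : Polynomial A} (hF : F ∈ S) (hmon : F.Monic) (hpos : 0 < F.natDegree) : S.FG := by
  classical
  have : IsNoetherianRing S₀ := isNoetherianRing_of_fg hfg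
  obtain ⟨D, hnD, hD⟩ := exists_leadingIdeal_le S S₀ hC hF hmon hpos
  set I := leadingIdeal S S₀ hC with hI
  have hIfg : ∀ d, ∃ T : Finset S₀, Ideal.span (T : Set S₀) = I d := fun d =>
    IsNoetherian.noetherian (I d)
  choose T hT using hIfg
  have hlift : ∀ (d : ℕ) (c : S₀), ∃ f, c ∈ I d → f ∈ S ∧ f.natDegree ≤ d ∧ f.coeff d = c := by
    intro d c
    by_cases h : c ∈ I d
    · obtain ⟨f, h1, h2, h3⟩ := h
      exact ⟨f, fun _ => ⟨h1, h2, h3⟩⟩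
    · exact ⟨0, fun h' => absurd h' h⟩
  choose L hL using hlift
  obtain ⟨G, hG⟩ := hfg
  let gens : Finset (Polynomial A) :=
    G.image Polynomial.C ∪ {F} ∪ (Finset.range D).biUnion fun d => (T d).image (L d)
  set S' := Algebra.adjoin k (gens : Set (Polynomial A)) with hS'
  have hgens : ∀ f ∈ gens, f ∈ S' := fun f hf => Algebra.subset_adjoin hf
  have hFS' : F ∈ S' := hgens F (by simp [gens])
  have hCS' : ∀ c ∈ S₀, Polynomial.C c ∈ S' := by
    have : S₀ ≤ S'.comap Polynomial.CAlgHom := by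
      rw [← hG, Algebra.adjoin_le_iff]
      intro c hc
      exact hgens _ (Finset.mem_union_left _ (Finset.mem_union_left _
        (Finset.mem_image_of_mem _ hc)))
    exact fun c hc => this hc
  have hSS : S' ≤ S := by
    rw [hS', Algebra.adjoin_le_iff]
    intro f hf
    simp only [gens, Finset.coe_union, Finset.coe_image, Finset.coe_singleton, Set.mem_union,
      Set.mem_image, Set.mem_singleton_iff, Finset.mem_coe, Finset.mem_biUnion,
      Finset.mem_image] at hf
    rcases hf with (⟨c, hc, rfl⟩ | rfl) | ⟨d, -, c, hc, rfl⟩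
    · exact hC c (hG ▸ Algebra.subset_adjoin hc)
    · exact hF
    · exact (hL d c (hT d ▸ Ideal.subset_span hc)).1
  have hlow : ∀ d, d < D → ∀ c ∈ I d, ∃ f ∈ S', f.natDegree ≤ d ∧ f.coeff d = c := by
    intro d hd c hc
    rw [← hT d] at hc
    induction hc using Submodule.span_induction with
    | mem c hc =>
      have h := hL d c (hT d ▸ Ideal.subset_span hc)
      exact ⟨L d c, hgens _ (Finset.mem_union_right _ (Finset.mem_biUnion.mpr
        ⟨d, Finset.mem_range.mpr hd, Finset.mem_image_of_mem _ hc⟩)), h.2⟩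
    | zero => exact ⟨0, S'.zero_mem, by simp, by simp⟩
    | add a b _ _ ha hb =>
      obtain ⟨f, hf, hfd, hfa⟩ := ha
      obtain ⟨g, hg, hgd, hgb⟩ := hb
      exact ⟨f + g, S'.add_mem hf hg, Polynomial.natDegree_add_le_of_degree_le hfd hgd,
        by rw [Polynomial.coeff_add, hfa, hgb]; rfl⟩
    | smul c a _ ha =>
      obtain ⟨f, hf, hfd, hfa⟩ := ha
      exact ⟨Polynomial.C (c : A) * f, S'.mul_mem (hCS' c c.2) hf,
        (Polynomial.natDegree_C_mul_le _ _).trans hfd, by rw [Polynomial.coeff_C_mul, hfa]; rfl⟩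
  have hmain : ∀ d : ℕ, ∀ f ∈ S, f.degree < d → f ∈ S' := by
    intro d
    induction d using Nat.strong_induction_on with
    | _ d ih =>
    intro f hf hfd
    rcases eq_or_ne f 0 with rfl | hf0
    · exact S'.zero_mem
    rw [Polynomial.degree_eq_natDegree hf0, Nat.cast_lt] at hfd
    set e := f.natDegree with he
    -- A `g ∈ S'` of degree `e` with the leading coefficient of `f` reduces the degree.
    suffices h : ∃ g ∈ S', g.natDegree ≤ e ∧ g.coeff e = f.coeff e by
      obtain ⟨g, hg, hge, hgc⟩ := h
      have h1 : f - g ∈ S' := by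
        refine ih e hfd _ (S.sub_mem hf (hSS hg)) ?_
        rw [Polynomial.degree_lt_iff_coeff_zero]
        intro i hi
        rcases hi.eq_or_lt with rfl | hi
        · rw [Polynomial.coeff_sub, hgc, sub_self]
        · rw [Polynomial.coeff_sub, Polynomial.coeff_eq_zero_of_natDegree_lt (by omega),
            Polynomial.coeff_eq_zero_of_natDegree_lt (by omega), sub_self]
      simpa using S'.add_mem h1 hg
    have hmem : (⟨f.coeff e, hlc f hf⟩ : S₀) ∈ I e := ⟨f, hf, le_rfl, rfl⟩
    rcases lt_or_ge e D with heD | heD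
    · exact hlow e heD _ hmem
    · obtain ⟨g, hg, hgd, hgc⟩ := hD e heD hmem
      have hg' : g ∈ S' := by
        refine ih (e - F.natDegree + 1) (by omega) g hg ?_
        refine Polynomial.degree_le_natDegree.trans_lt ?_
        rw [Nat.cast_lt]
        omega
      refine ⟨g * F, S'.mul_mem hg' hFS', ?_, ?_⟩
      · exact (Polynomial.natDegree_mul_le_of_le hgd le_rfl).trans (by omega)
      · have h2 := Polynomial.coeff_mul_add_eq_of_natDegree_le hgd (le_refl F.natDegree)
        rw [Nat.sub_add_cancel (hnD.trans heD), hgc, hmon.coeff_natDegree, mul_one] at h2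
        exact h2
  refine ⟨gens, le_antisymm hSS fun f hf => hmain (f.natDegree + 1) f hf ?_⟩
  exact Polynomial.degree_le_natDegree.trans_lt (by exact_mod_cast Nat.lt_succ_self _)

/-- A homomorphism `θ` on `A[X]` that extends `θ₀` on `A` and moves `X` to `X + τ U` acts on
leading coefficients through `θ₀`: exchange the two variables of `A[X][U]`; then `θ` is `θ₀` on
coefficients followed by the Taylor shift by `τ U`. -/
theorem leadingCoeff_mem_fixedRing {θ₀ : A →ₐ[k] Polynomial A}
    (h0 : ∀ a, (θ₀ a).coeff 0 = a)
    {θ : Polynomial A →ₐ[k] Polynomial (Polynomial A)}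
    (hθC : ∀ a, θ (Polynomial.C a) = (θ₀ a).map Polynomial.C) {τ : A}
    (hθX : θ Polynomial.X =
      Polynomial.C Polynomial.X + Polynomial.C (Polynomial.C τ) * Polynomial.X)
    {f : Polynomial A} (hf : f ∈ fixedRing θ) : f.leadingCoeff ∈ fixedRing θ₀ := by
  have hinj : Function.Injective (θ₀ : A →+* Polynomial A) := fun a b hab => by
    have hab' : θ₀ a = θ₀ b := hab
    rw [← h0 a, ← h0 b, hab']
  have hcomp : ((Polynomial.Bivariate.swap : Polynomial (Polynomial A) ≃ₐ[A] _) :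
        Polynomial (Polynomial A) →+* Polynomial (Polynomial A)).comp (θ : Polynomial A →+* _) =
      ((Polynomial.taylorAlgHom (Polynomial.C τ * Polynomial.X) :
        Polynomial (Polynomial A) →ₐ[Polynomial A] _) : _ →+* _).comp
        (Polynomial.mapRingHom (θ₀ : A →+* Polynomial A)) := by
    apply Polynomial.ringHom_ext
    · intro a
      simp [hθC, Polynomial.Bivariate.swap_map_C]
    · simp [hθX, Polynomial.Bivariate.swap_Y, Polynomial.Bivariate.swap_C]
  have h1 := RingHom.congr_fun hcomp f
  rw [mem_fixedRing] at hf ⊢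
  have h2 : Polynomial.taylor (Polynomial.C τ * Polynomial.X)
      (f.map (θ₀ : A →+* Polynomial A)) = f.map Polynomial.C := by
    rw [← Polynomial.Bivariate.swap_C, ← hf]
    exact h1.symm
  have h3 := Polynomial.coeff_taylor_natDegree (Polynomial.C τ * Polynomial.X)
    (f.map (θ₀ : A →+* Polynomial A))
  rw [h2, Polynomial.natDegree_map_eq_of_injective hinj, Polynomial.coeff_map,
    Polynomial.leadingCoeff_map_of_injective hinj] at h3
  exact h3.symm

end LeadingCoefficients

/-! ### Two criteria for membership in a subalgebra -/

section Saturation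

variable {k R R' I : Type*} [Field k] [CommRing R] [Algebra k R] [CommRing R'] [Algebra k R']

theorem linearIndependent_monomial {V : Type*} {g : I → V →₀ ℕ} (hg : Function.Injective g)
    {c : I → k} (hc : ∀ i, c i ≠ 0) :
    LinearIndependent k fun i => MvPolynomial.monomial (g i) (c i) := by
  have h := ((MvPolynomial.basisMonomials V k).linearIndependent.comp g hg).units_smul
    fun i => Units.mk0 (c i) (hc i)
  convert! h using 1
  funext i
  simp [Units.smul_def, MvPolynomial.smul_monomial]

/-- The space of normal forms of an algebra `S` modulo `x`: multiples of `x` in `S`, and linear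
combinations of the elements `n i`. -/
def normalForms (S : Subalgebra k R) (x : R) (n : I → R) : Submodule k R :=
  (Subalgebra.toSubmodule S).map (LinearMap.mulLeft k x) ⊔ Submodule.span k (Set.range n)

theorem mul_mem_normalForms {S : Subalgebra k R} {x : R} {n : I → R} {s : R} (hs : s ∈ S) :
    x * s ∈ normalForms S x n :=
  Submodule.mem_sup_left ⟨s, hs, rfl⟩

theorem apply_mem_normalForms (S : Subalgebra k R) (x : R) (n : I → R) (i : I) :
    n i ∈ normalForms S x n :=
  Submodule.mem_sup_right (Submodule.subset_span ⟨i, rfl⟩)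

/-- Let `S` be generated by `G`, and let products of generators with normal forms `n i` again have
a normal form modulo `x S`. If a homomorphism that kills `x` keeps the `n i` linearly independent,
then `S ∩ x R = x S`. -/
theorem mem_adjoin_of_mul_mem [IsDomain R] {G : Set R} {x : R} (hx0 : x ≠ 0)
    (ρ : R →ₐ[k] R') (hρ : ρ x = 0) {n : I → R} (hn : LinearIndependent k fun i => ρ (n i))
    {i₀ : I} (h1 : n i₀ = 1)
    (hmul : ∀ g ∈ G, ∀ i, g * n i ∈ normalForms (Algebra.adjoin k G) x n)
    {b : R} (hb : x * b ∈ Algebra.adjoin k G) : b ∈ Algebra.adjoin k G := by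
  set S := Algebra.adjoin k G with hS
  have key : ∀ c ∈ S, ∀ w ∈ normalForms S x n, c * w ∈ normalForms S x n := by
    intro c hc
    induction hc using Algebra.adjoin_induction with
    | mem g hg =>
      intro w hw
      obtain ⟨_, ⟨s, hs, rfl⟩, z, hz, rfl⟩ := Submodule.mem_sup.mp hw
      rw [mul_add]
      refine Submodule.add_mem _ ?_ ?_
      · rw [LinearMap.mulLeft_apply, mul_left_comm]
        exact mul_mem_normalForms (S.mul_mem (Algebra.subset_adjoin hg) hs)
      · clear hw
        induction hz using Submodule.span_induction with
        | mem z hz =>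
          obtain ⟨i, rfl⟩ := hz
          exact hmul g hg i
        | zero => rw [mul_zero]; exact Submodule.zero_mem _
        | add a b _ _ ha hb =>
          rw [mul_add]
          exact Submodule.add_mem _ ha hb
        | smul r a _ ha =>
          rw [mul_smul_comm]
          exact Submodule.smul_mem _ _ ha
    | algebraMap r =>
      intro w hw
      rw [← Algebra.smul_def]
      exact Submodule.smul_mem _ _ hw
    | add a b _ _ ha hb =>
      intro w hw
      rw [add_mul]
      exact Submodule.add_mem _ (ha w hw) (hb w hw)
    | mul a b _ _ ha hb =>
      intro w hw
      rw [mul_assoc]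
      exact ha _ (hb w hw)
  have hxb : x * b ∈ normalForms S x n := by
    have := key _ hb 1 (h1 ▸ apply_mem_normalForms S x n i₀)
    rwa [mul_one] at this
  obtain ⟨_, ⟨s, hs, rfl⟩, z, hz, hsum⟩ := Submodule.mem_sup.mp hxb
  rw [LinearMap.mulLeft_apply] at hsum
  have hz0 : ρ z = 0 := by
    have := congrArg ρ hsum
    simpa [hρ] using this
  obtain ⟨l, rfl⟩ := (Finsupp.mem_span_range_iff_exists_finsupp).mp hz
  have hl : l = 0 := by
    rw [linearIndependent_iff] at hn
    apply hn
    rw [Finsupp.linearCombination_apply]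
    simpa [Finsupp.sum, map_sum] using hz0
  rw [hl, Finsupp.sum_zero_index, add_zero] at hsum
  rw [← mul_left_cancel₀ hx0 hsum]
  exact hs

/-- The elements of a field `K` that some power of `x` moves into the image of `S`. -/
def awaySubalgebra {K : Type*} [Field K] [Algebra k K] (φ : R →ₐ[k] K) (S : Subalgebra k R)
    {x : R} (hx : x ∈ S) : Subalgebra k K where
  carrier := {a | ∃ N : ℕ, ∃ c ∈ S, φ x ^ N * a = φ c}
  mul_mem' := by
    rintro a b ⟨N, c, hc, h⟩ ⟨N', c', hc', h'⟩
    exact ⟨N + N', c * c', S.mul_mem hc hc', by rw [map_mul, ← h, ← h']; ring⟩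
  add_mem' := by
    rintro a b ⟨N, c, hc, h⟩ ⟨N', c', hc', h'⟩
    exact ⟨N + N', x ^ N' * c + x ^ N * c',
      S.add_mem (S.mul_mem (S.pow_mem hx _) hc) (S.mul_mem (S.pow_mem hx _) hc'),
      by rw [map_add, map_mul, map_mul, map_pow, map_pow, ← h, ← h']; ring⟩
  algebraMap_mem' := fun r => ⟨0, algebraMap k R r, S.algebraMap_mem r, by simp⟩

/-- On the fixed ring of `θ`, the substitution of any `σ` for `U` in `θ b` gives back `b`. If `σ`
is chosen so that the images of all variables lie in `S[1/x]`, then the fixed ring is contained in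
`S[1/x]`, and therefore in `S` when `S ∩ x R = x S`. -/
theorem fixedRing_le_of_slice {V : Type*}
    {f : V → Polynomial (MvPolynomial V k)} {S : Subalgebra k (MvPolynomial V k)}
    {x : MvPolynomial V k} (hxS : x ∈ S) (σ : FractionRing (MvPolynomial V k))
    (hσ : ∀ i, ∃ N : ℕ, ∃ c ∈ S,
      algebraMap _ (FractionRing (MvPolynomial V k)) x ^ N * Polynomial.aeval σ (f i) =
        algebraMap _ _ c)
    (hsat : ∀ b, x * b ∈ S → b ∈ S) :
    fixedRing (MvPolynomial.aeval f : _ →ₐ[k] Polynomial (MvPolynomial V k)) ≤ S := by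
  intro b hb
  let φ : MvPolynomial V k →ₐ[k] FractionRing (MvPolynomial V k) :=
    (Algebra.ofId (MvPolynomial V k) (FractionRing (MvPolynomial V k))).restrictScalars k
  let e : Polynomial (MvPolynomial V k) →ₐ[k] FractionRing (MvPolynomial V k) :=
    (Polynomial.aeval σ : _ →ₐ[MvPolynomial V k] _).restrictScalars k
  have hmem : ∀ a : MvPolynomial V k, e (MvPolynomial.aeval f a) ∈ awaySubalgebra φ S hxS := by
    intro a
    induction a using MvPolynomial.induction_on with
    | C r =>
      have : e (MvPolynomial.aeval f (MvPolynomial.C r)) = algebraMap k _ r := by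
        rw [← MvPolynomial.algebraMap_eq, AlgHom.commutes, AlgHom.commutes]
      rw [this]
      exact Subalgebra.algebraMap_mem _ r
    | add p q hp hq =>
      rw [map_add, map_add]
      exact Subalgebra.add_mem _ hp hq
    | mul_X p i hp =>
      rw [map_mul, map_mul, MvPolynomial.aeval_X]
      exact Subalgebra.mul_mem _ hp (hσ i)
  obtain ⟨N, c, hc, h⟩ := hmem b
  rw [mem_fixedRing] at hb
  have hb' : e (MvPolynomial.aeval f b) = φ b := by
    rw [hb]
    exact Polynomial.aeval_C _ _
  rw [hb', ← map_pow, ← map_mul] at h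
  have h' : x ^ N * b = c := IsFractionRing.injective (MvPolynomial V k) _ h
  have hN : x ^ N * b ∈ S := h' ▸ hc
  clear h h' hb'
  induction N with
  | zero => simpa using hN
  | succ N ih => exact ih (hsat _ (by rwa [pow_succ', mul_assoc] at hN))

end Saturation

/-! ### Invariants of three pairs of variables -/

section Pairs

/-- The variables of `k[x₁, x₂, x₃, y₁, y₂, y₃]`. -/
inductive PairVar : Type
  | x (i : Fin 3) | y (i : Fin 3)

/-- The images `x i ↦ x i` and `y i ↦ y i + (x i) ^ M * U` of the variables. -/
noncomputable def pairImage (k : Type*) [CommRing k] (M : ℕ) :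
    PairVar → Polynomial (MvPolynomial PairVar k)
  | .x i => Polynomial.C (MvPolynomial.X (.x i))
  | .y i => Polynomial.C (MvPolynomial.X (.y i)) +
      Polynomial.C (MvPolynomial.X (.x i) ^ M) * Polynomial.X

variable (k : Type*) [Field k]

/-- The `2 × 2` minor `(x i) ^ M * y j - (x j) ^ M * y i`. -/
noncomputable def pairMinor (M : ℕ) (i j : Fin 3) : MvPolynomial PairVar k :=
  MvPolynomial.X (.x i) ^ M * MvPolynomial.X (.y j) -
    MvPolynomial.X (.x j) ^ M * MvPolynomial.X (.y i)

/-- The variables `x i` and the minors. -/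
def pairGenerators (M : ℕ) : Set (MvPolynomial PairVar k) :=
  {MvPolynomial.X (.x 0), MvPolynomial.X (.x 1), MvPolynomial.X (.x 2),
    pairMinor k M 0 1, pairMinor k M 0 2, pairMinor k M 1 2}

theorem pairMinor_relation (M : ℕ) :
    (MvPolynomial.X (.x 2) : MvPolynomial PairVar k) ^ M * pairMinor k M 0 1 =
      MvPolynomial.X (.x 0) ^ M * -pairMinor k M 1 2 +
        MvPolynomial.X (.x 1) ^ M * pairMinor k M 0 2 := by
  unfold pairMinor
  ring

/-- Exponents `(i, j, a, b, c)` of the products `x₂ ^ i * x₃ ^ j * f₁₂ ^ a * f₁₃ ^ b * f₂₃ ^ c` of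
variables and minors that are in normal form with respect to the relation
`x₃ ^ M * f₁₂ = x₂ ^ M * f₁₃ - x₁ ^ M * f₂₃`. -/
structure PairExponent (M : ℕ) where
  i : ℕ
  j : ℕ
  a : ℕ
  b : ℕ
  c : ℕ
  normal : j < M ∨ a = 0

/-- The product of variables and minors with given exponents. -/
noncomputable def pairNormal (M : ℕ) (e : PairExponent M) : MvPolynomial PairVar k :=
  MvPolynomial.X (.x 1) ^ e.i * MvPolynomial.X (.x 2) ^ e.j *
    pairMinor k M 0 1 ^ e.a * pairMinor k M 0 2 ^ e.b * pairMinor k M 1 2 ^ e.c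

theorem mul_pairNormal_mem {M : ℕ} (hM : 0 < M) {g : MvPolynomial PairVar k}
    (hg : g ∈ pairGenerators k M) (e : PairExponent M) :
    g * pairNormal k M e ∈ normalForms (Algebra.adjoin k (pairGenerators k M))
      (MvPolynomial.X (.x 0)) (pairNormal k M) := by
  obtain ⟨i, j, a, b, c, h⟩ := e
  set S := Algebra.adjoin k (pairGenerators k M) with hS
  have hx0 : MvPolynomial.X (.x 0) ∈ S := Algebra.subset_adjoin (by simp [pairGenerators])
  have hx1 : MvPolynomial.X (.x 1) ∈ S := Algebra.subset_adjoin (by simp [pairGenerators])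
  have hx2 : MvPolynomial.X (.x 2) ∈ S := Algebra.subset_adjoin (by simp [pairGenerators])
  have h01 : pairMinor k M 0 1 ∈ S := Algebra.subset_adjoin (by simp [pairGenerators])
  have h02 : pairMinor k M 0 2 ∈ S := Algebra.subset_adjoin (by simp [pairGenerators])
  have h12 : pairMinor k M 1 2 ∈ S := Algebra.subset_adjoin (by simp [pairGenerators])
  have hprod : ∀ i j a b c : ℕ, (MvPolynomial.X (.x 1) : MvPolynomial PairVar k) ^ i *
      MvPolynomial.X (.x 2) ^ j * pairMinor k M 0 1 ^ a * pairMinor k M 0 2 ^ b *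
        pairMinor k M 1 2 ^ c ∈ S := fun i j a b c =>
    S.mul_mem (S.mul_mem (S.mul_mem (S.mul_mem (S.pow_mem hx1 _) (S.pow_mem hx2 _))
      (S.pow_mem h01 _)) (S.pow_mem h02 _)) (S.pow_mem h12 _)
  -- A product that contains `x₃ ^ M * f₁₂` is rewritten by the relation.
  have hrew : ∀ i j a b c, (j < M ∨ a = 0) →
      MvPolynomial.X (.x 2) ^ M * pairMinor k M 0 1 *
        ((MvPolynomial.X (.x 1) : MvPolynomial PairVar k) ^ i *
        MvPolynomial.X (.x 2) ^ j * pairMinor k M 0 1 ^ a * pairMinor k M 0 2 ^ b *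
        pairMinor k M 1 2 ^ c) ∈ normalForms S (MvPolynomial.X (.x 0)) (pairNormal k M) := by
    intro i j a b c h
    obtain ⟨M', rfl⟩ : ∃ M', M = M' + 1 := ⟨M - 1, by omega⟩
    have h1 := mul_mem_normalForms (n := pairNormal k (M' + 1)) (x := MvPolynomial.X (.x 0))
      (S.mul_mem (S.pow_mem hx0 M') (S.neg_mem (hprod i j a b (c + 1))))
    have h2 := apply_mem_normalForms S (MvPolynomial.X (.x 0)) (pairNormal k (M' + 1))
      ⟨i + (M' + 1), j, a, b + 1, c, h⟩
    convert Submodule.add_mem _ h1 h2 using 1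
    rw [pairMinor_relation]
    simp only [pairNormal]
    ring
  have happ := apply_mem_normalForms S (MvPolynomial.X (.x 0)) (pairNormal k M)
  simp only [pairGenerators, Set.mem_insert_iff, Set.mem_singleton_iff] at hg
  rcases hg with rfl | rfl | rfl | rfl | rfl | rfl
  · exact mul_mem_normalForms (hprod i j a b c)
  · convert happ ⟨i + 1, j, a, b, c, h⟩ using 1
    simp only [pairNormal]
    ring
  · by_cases h' : j + 1 < M ∨ a = 0
    · convert happ ⟨i, j + 1, a, b, c, h'⟩ using 1
      simp only [pairNormal]
      ring
    · obtain ⟨a', rfl⟩ : ∃ a', a = a' + 1 := ⟨a - 1, by omega⟩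
      obtain rfl : M = j + 1 := by omega
      convert hrew i 0 a' b c (Or.inl hM) using 1
      simp only [pairNormal]
      ring
  · by_cases h' : j < M ∨ a + 1 = 0
    · convert happ ⟨i, j, a + 1, b, c, h'⟩ using 1
      simp only [pairNormal]
      ring
    · obtain rfl : a = 0 := by omega
      obtain ⟨j', rfl⟩ : ∃ j', j = M + j' := ⟨j - M, by omega⟩
      convert hrew i j' 0 b c (Or.inr rfl) using 1
      simp only [pairNormal]
      ring
  · convert happ ⟨i, j, a, b + 1, c, h⟩ using 1
    simp only [pairNormal]
    ring
  · convert happ ⟨i, j, a, b, c + 1, h⟩ using 1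
    simp only [pairNormal]
    ring

/-- The specialization `x₁ = 0`, `y₂ = 0`, which turns the minors into monomials. -/
noncomputable def pairSpecialization : MvPolynomial PairVar k →ₐ[k] MvPolynomial PairVar k :=
  MvPolynomial.aeval fun
    | .x 0 => 0
    | .y 1 => 0
    | z => MvPolynomial.X z

theorem linearIndependent_pairSpecialization {M : ℕ} (hM : 0 < M) :
    LinearIndependent k fun e => pairSpecialization k (pairNormal k M e) := by
  have hX : ∀ z, pairSpecialization k (MvPolynomial.X z) = (match z with
    | .x 0 => 0
    | .y 1 => 0
    | z => MvPolynomial.X z) := fun z => by rw [pairSpecialization, MvPolynomial.aeval_X]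
  have key : ∀ e : PairExponent M, pairSpecialization k (pairNormal k M e) =
      MvPolynomial.monomial (Finsupp.single (.x 1) (e.i + M * e.a + M * e.c) +
        (Finsupp.single (.x 2) (e.j + M * e.b) + (Finsupp.single (.y 0) (e.a + e.b) +
          Finsupp.single (.y 2) e.c))) ((-1) ^ (e.a + e.b)) := by
    intro e
    simp only [MvPolynomial.monomial_single_add, pairNormal, pairMinor, map_mul, map_pow, map_sub,
      hX, ← MvPolynomial.C_mul_X_pow_eq_monomial, zero_pow hM.ne', map_neg, map_one]
    ring
  simp only [key]
  refine linearIndependent_monomial ?_ fun e => pow_ne_zero _ (neg_ne_zero.mpr one_ne_zero)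
  intro e e' h
  have e1 := DFunLike.congr_fun h (.x 1)
  have e2 := DFunLike.congr_fun h (.x 2)
  have e3 := DFunLike.congr_fun h (.y 0)
  have e4 := DFunLike.congr_fun h (.y 2)
  simp at e1 e2 e3 e4
  obtain ⟨i, j, a, b, c, h1⟩ := e
  obtain ⟨i', j', a', b', c', h1'⟩ := e'
  simp only at e1 e2 e3 e4
  -- `b` is at most the quotient of `j + M b` by `M`, with equality if `j < M`; and `b` is
  -- `a + b` if `a = 0`.
  obtain rfl : b = b' := by
    rcases lt_trichotomy b b' with hlt | heq | hlt
    · have : M * (b + 1) ≤ M * b' := Nat.mul_le_mul_left _ hlt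
      rw [mul_add] at this
      omega
    · exact heq
    · have : M * (b' + 1) ≤ M * b := Nat.mul_le_mul_left _ hlt
      rw [mul_add] at this
      omega
  obtain rfl : a = a' := by omega
  subst e4
  obtain rfl : i = i' := by omega
  obtain rfl : j = j' := by omega
  rfl

theorem fixedRing_pairImage_fg {M : ℕ} (hM : 0 < M) :
    (fixedRing (MvPolynomial.aeval (pairImage k M) :
      _ →ₐ[k] Polynomial (MvPolynomial PairVar k))).FG := by
  have hge : Algebra.adjoin k (pairGenerators k M) ≤ fixedRing (MvPolynomial.aeval
      (pairImage k M) : _ →ₐ[k] Polynomial (MvPolynomial PairVar k)) := by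
    rw [Algebra.adjoin_le_iff]
    intro g hg
    simp only [pairGenerators, Set.mem_insert_iff, Set.mem_singleton_iff] at hg
    rw [SetLike.mem_coe, mem_fixedRing]
    rcases hg with rfl | rfl | rfl | rfl | rfl | rfl <;>
      simp only [pairMinor, map_sub, map_mul, map_pow, MvPolynomial.aeval_X, pairImage] <;> ring
  have hx : (MvPolynomial.X (.x 0) : MvPolynomial PairVar k) ∈
      Algebra.adjoin k (pairGenerators k M) := Algebra.subset_adjoin (by simp [pairGenerators])
  set K := FractionRing (MvPolynomial PairVar k)
  have hx0 : algebraMap _ K (MvPolynomial.X (.x 0) : MvPolynomial PairVar k) ≠ 0 := by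
    simp
  have hle := fixedRing_le_of_slice (f := pairImage k M) hx
    (-algebraMap (MvPolynomial PairVar k) K (MvPolynomial.X (.y 0)) /
      algebraMap (MvPolynomial PairVar k) K (MvPolynomial.X (.x 0)) ^ M) ?_ ?_
  · rw [le_antisymm hle hge]
    have hfin : (pairGenerators k M).Finite := by simp [pairGenerators]
    exact ⟨hfin.toFinset, by simp⟩
  · intro z
    have hvar : ∀ i, (MvPolynomial.X (.x i) : MvPolynomial PairVar k) ∈
        Algebra.adjoin k (pairGenerators k M) := fun i => Algebra.subset_adjoin (by
      fin_cases i <;> simp [pairGenerators])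
    rcases z with i | i
    · exact ⟨0, _, hvar i, by simp [pairImage]⟩
    · have hmin : pairMinor k M 0 i ∈ Algebra.adjoin k (pairGenerators k M) := by
        fin_cases i
        · convert Subalgebra.zero_mem _ using 1
          simp [pairMinor]
        · exact Algebra.subset_adjoin (by simp [pairGenerators])
        · exact Algebra.subset_adjoin (by simp [pairGenerators])
      refine ⟨M, _, hmin, ?_⟩
      simp only [pairImage, pairMinor, map_add, map_sub, map_mul, map_pow, Polynomial.aeval_C,
        Polynomial.aeval_X]
      field_simp
      ring
  · intro b hb
    refine mem_adjoin_of_mul_mem (MvPolynomial.X_ne_zero _) (pairSpecialization k) ?_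
      (linearIndependent_pairSpecialization k hM) (i₀ := ⟨0, 0, 0, 0, 0, Or.inr rfl⟩) ?_
      (fun g hg e => mul_pairNormal_mem k hM hg e) hb
    · simp [pairSpecialization]
    · simp [pairNormal]

end Pairs

/-! ### Invariants of the binary cubic -/

section Cubic

/-- The variables of `k[x, y, s, t, u]`. -/
inductive CubicVar : Type
  | x | y | s | t | u

/-- The images of the variables of `k[x, y, s, t, u]`, with `M` in place of `m + 1`. They are the
ones for which the coefficients of `x ^ M * y ^ (2 * M) * Z ^ 3 + 3 * y ^ (2 * M) * s * Z ^ 2 +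
3 * y ^ M * t * Z + u` move to those of the polynomial in `Z + U`. -/
noncomputable def cubicImage (k : Type*) [CommRing k] (M : ℕ) :
    CubicVar → Polynomial (MvPolynomial CubicVar k) :=
  let x : MvPolynomial CubicVar k := MvPolynomial.X .x
  let y : MvPolynomial CubicVar k := MvPolynomial.X .y
  let s : MvPolynomial CubicVar k := MvPolynomial.X .s
  let t : MvPolynomial CubicVar k := MvPolynomial.X .t
  let u : MvPolynomial CubicVar k := MvPolynomial.X .u
  let U : Polynomial (MvPolynomial CubicVar k) := Polynomial.X
  fun
  | .x => Polynomial.C x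
  | .y => Polynomial.C y
  | .s => Polynomial.C s + Polynomial.C (x ^ M) * U
  | .t => Polynomial.C t + Polynomial.C (2 * y ^ M * s) * U + Polynomial.C (x ^ M * y ^ M) * U ^ 2
  | .u => Polynomial.C u + Polynomial.C (3 * y ^ M * t) * U +
      Polynomial.C (3 * y ^ (2 * M) * s) * U ^ 2 + Polynomial.C (x ^ M * y ^ (2 * M)) * U ^ 3

variable (k : Type*) [Field k]

/-- The quadratic invariant `f₂` of the cubic. -/
noncomputable def cubicQuad (M : ℕ) : MvPolynomial CubicVar k :=
  let x : MvPolynomial CubicVar k := MvPolynomial.X .x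
  let y : MvPolynomial CubicVar k := MvPolynomial.X .y
  let s : MvPolynomial CubicVar k := MvPolynomial.X .s
  let t : MvPolynomial CubicVar k := MvPolynomial.X .t
  x ^ M * t - y ^ M * s ^ 2

/-- The cubic invariant `f₃` of the cubic. -/
noncomputable def cubicCub (M : ℕ) : MvPolynomial CubicVar k :=
  let x : MvPolynomial CubicVar k := MvPolynomial.X .x
  let y : MvPolynomial CubicVar k := MvPolynomial.X .y
  let s : MvPolynomial CubicVar k := MvPolynomial.X .s
  let t : MvPolynomial CubicVar k := MvPolynomial.X .t
  let u : MvPolynomial CubicVar k := MvPolynomial.X .u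
  x ^ (2 * M) * u - 3 * x ^ M * y ^ M * s * t + 2 * y ^ (2 * M) * s ^ 3

/-- The discriminant `Δ` of the cubic. -/
noncomputable def cubicDisc (M : ℕ) : MvPolynomial CubicVar k :=
  let x : MvPolynomial CubicVar k := MvPolynomial.X .x
  let y : MvPolynomial CubicVar k := MvPolynomial.X .y
  let s : MvPolynomial CubicVar k := MvPolynomial.X .s
  let t : MvPolynomial CubicVar k := MvPolynomial.X .t
  let u : MvPolynomial CubicVar k := MvPolynomial.X .u
  x ^ (2 * M) * u ^ 2 - 6 * x ^ M * y ^ M * s * t * u + 4 * x ^ M * y ^ M * t ^ 3 +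
    4 * y ^ (2 * M) * u * s ^ 3 - 3 * y ^ (2 * M) * s ^ 2 * t ^ 2

theorem cubicCub_sq (M : ℕ) : cubicCub k M ^ 2 = MvPolynomial.X .x ^ (2 * M) * cubicDisc k M -
    4 * MvPolynomial.X .y ^ M * cubicQuad k M ^ 3 := by
  simp only [cubicCub, cubicDisc, cubicQuad]
  ring

/-- The generators of the invariants in characteristic different from two. -/
def cubicGenerators (M : ℕ) : Set (MvPolynomial CubicVar k) :=
  {MvPolynomial.X .x, MvPolynomial.X .y, cubicQuad k M, cubicCub k M, cubicDisc k M}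

/-- The normal forms `y ^ i * f₂ ^ j * Δ ^ l * f₃ ^ ε` with `ε ∈ {0, 1}`. -/
noncomputable def cubicNormal (M : ℕ) (e : (ℕ × ℕ × ℕ) × Bool) : MvPolynomial CubicVar k :=
  MvPolynomial.X .y ^ e.1.1 * cubicQuad k M ^ e.1.2.1 * cubicDisc k M ^ e.1.2.2 *
    cubicCub k M ^ e.2.toNat

theorem mul_cubicNormal_mem {M : ℕ} (hM : 0 < M) {g : MvPolynomial CubicVar k}
    (hg : g ∈ cubicGenerators k M) (e : (ℕ × ℕ × ℕ) × Bool) :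
    g * cubicNormal k M e ∈ normalForms (Algebra.adjoin k (cubicGenerators k M))
      (MvPolynomial.X .x) (cubicNormal k M) := by
  obtain ⟨⟨i, j, l⟩, ε⟩ := e
  set S := Algebra.adjoin k (cubicGenerators k M) with hS
  have hx : MvPolynomial.X .x ∈ S := Algebra.subset_adjoin (by simp [cubicGenerators])
  have hy : MvPolynomial.X .y ∈ S := Algebra.subset_adjoin (by simp [cubicGenerators])
  have h2 : cubicQuad k M ∈ S := Algebra.subset_adjoin (by simp [cubicGenerators])
  have h3 : cubicCub k M ∈ S := Algebra.subset_adjoin (by simp [cubicGenerators])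
  have hD : cubicDisc k M ∈ S := Algebra.subset_adjoin (by simp [cubicGenerators])
  have hprod : ∀ e, cubicNormal k M e ∈ S := fun e =>
    S.mul_mem (S.mul_mem (S.mul_mem (S.pow_mem hy _) (S.pow_mem h2 _)) (S.pow_mem hD _))
      (S.pow_mem h3 _)
  have happ := apply_mem_normalForms S (MvPolynomial.X .x) (cubicNormal k M)
  simp only [cubicGenerators, Set.mem_insert_iff, Set.mem_singleton_iff] at hg
  rcases hg with rfl | rfl | rfl | rfl | rfl
  · exact mul_mem_normalForms (hprod _)
  · convert happ ⟨⟨i + 1, j, l⟩, ε⟩ using 1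
    simp only [cubicNormal]
    ring
  · convert happ ⟨⟨i, j + 1, l⟩, ε⟩ using 1
    simp only [cubicNormal]
    ring
  · cases ε
    · convert happ ⟨⟨i, j, l⟩, true⟩ using 1
      simp only [cubicNormal, Bool.toNat_false, Bool.toNat_true]
      ring
    · obtain ⟨M', rfl⟩ : ∃ M', M = M' + 1 := ⟨M - 1, by omega⟩
      have h1 := mul_mem_normalForms (n := cubicNormal k (M' + 1)) (x := MvPolynomial.X .x)
        (S.mul_mem (S.pow_mem hx (2 * M' + 1)) (hprod ⟨⟨i, j, l + 1⟩, false⟩))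
      have h2 := Submodule.smul_mem _ (-4 : k) (happ ⟨⟨i + (M' + 1), j + 3, l⟩, false⟩)
      convert Submodule.add_mem _ h1 h2 using 1
      have h4 : ((-4 : k) • cubicNormal k (M' + 1) ⟨⟨i + (M' + 1), j + 3, l⟩, false⟩) =
          -4 * cubicNormal k (M' + 1) ⟨⟨i + (M' + 1), j + 3, l⟩, false⟩ := by
        rw [Algebra.smul_def, map_neg, map_ofNat]
      rw [h4]
      simp only [cubicNormal, Bool.toNat_false, Bool.toNat_true]
      linear_combination (MvPolynomial.X .y ^ i * cubicQuad k (M' + 1) ^ j *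
        cubicDisc k (M' + 1) ^ l) * cubicCub_sq k (M' + 1)
  · convert happ ⟨⟨i, j, l + 1⟩, ε⟩ using 1
    simp only [cubicNormal]
    ring

/-- The specialization `x = 0`, `t = 0`, `u = s * u`, which turns the invariants into monomials
whose degree in `s` is odd for `f₃` and even for the others. -/
noncomputable def cubicSpecialization : MvPolynomial CubicVar k →ₐ[k] MvPolynomial CubicVar k :=
  MvPolynomial.aeval fun
    | .x => 0
    | .t => 0
    | .u => MvPolynomial.X .s * MvPolynomial.X .u
    | z => MvPolynomial.X z

theorem linearIndependent_cubicSpecialization {M : ℕ} (hM : 0 < M) (h2 : (2 : k) ≠ 0) :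
    LinearIndependent k fun e => cubicSpecialization k (cubicNormal k M e) := by
  have hX : ∀ z, cubicSpecialization k (MvPolynomial.X z) = (match z with
    | .x => 0
    | .t => 0
    | .u => MvPolynomial.X .s * MvPolynomial.X .u
    | z => MvPolynomial.X z) := fun z => by rw [cubicSpecialization, MvPolynomial.aeval_X]
  have key : ∀ e : (ℕ × ℕ × ℕ) × Bool, cubicSpecialization k (cubicNormal k M e) =
      MvPolynomial.monomial
        (Finsupp.single .y (e.1.1 + M * e.1.2.1 + 2 * M * e.1.2.2 + 2 * M * e.2.toNat) +
        (Finsupp.single .s (2 * e.1.2.1 + 4 * e.1.2.2 + 3 * e.2.toNat) +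
          Finsupp.single .u e.1.2.2)) ((-1) ^ e.1.2.1 * 4 ^ e.1.2.2 * 2 ^ e.2.toNat) := by
    intro e
    simp only [MvPolynomial.monomial_single_add, cubicNormal, cubicQuad, cubicCub, cubicDisc,
      map_mul, map_pow, map_sub, map_add, hX, ← MvPolynomial.C_mul_X_pow_eq_monomial,
      zero_pow hM.ne', zero_pow (mul_pos two_pos hM).ne', map_neg, map_one, map_ofNat]
    ring
  simp only [key]
  have h4 : (4 : k) ≠ 0 := by
    rw [show (4 : k) = 2 * 2 by norm_num]
    exact mul_ne_zero h2 h2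
  refine linearIndependent_monomial ?_ fun e => mul_ne_zero (mul_ne_zero
    (pow_ne_zero _ (neg_ne_zero.mpr one_ne_zero)) (pow_ne_zero _ h4)) (pow_ne_zero _ h2)
  intro e e' h
  have e1 := DFunLike.congr_fun h .y
  have e2 := DFunLike.congr_fun h .s
  have e3 := DFunLike.congr_fun h .u
  simp at e1 e2 e3
  obtain ⟨⟨i, j, l⟩, ε⟩ := e
  obtain ⟨⟨i', j', l'⟩, ε'⟩ := e'
  simp only at e1 e2 e3
  subst e3
  obtain rfl : ε = ε' := by
    cases ε <;> cases ε' <;> simp at e2 ⊢ <;> omega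
  obtain rfl : j = j' := by omega
  obtain rfl : i = i' := by omega
  rfl

/-- In characteristic two the discriminant is the square of this invariant. -/
noncomputable def cubicMixed (M : ℕ) : MvPolynomial CubicVar k :=
  let x : MvPolynomial CubicVar k := MvPolynomial.X .x
  let y : MvPolynomial CubicVar k := MvPolynomial.X .y
  let s : MvPolynomial CubicVar k := MvPolynomial.X .s
  let t : MvPolynomial CubicVar k := MvPolynomial.X .t
  let u : MvPolynomial CubicVar k := MvPolynomial.X .u
  x ^ M * u - 3 * y ^ M * s * t

/-- The generators of the invariants in characteristic two. -/
def cubicGeneratorsTwo (M : ℕ) : Set (MvPolynomial CubicVar k) :=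
  {MvPolynomial.X .x, MvPolynomial.X .y, cubicQuad k M, cubicMixed k M}

/-- The products `y ^ i * f₂ ^ j * g ^ l`. -/
noncomputable def cubicNormalTwo (M : ℕ) (e : ℕ × ℕ × ℕ) : MvPolynomial CubicVar k :=
  MvPolynomial.X .y ^ e.1 * cubicQuad k M ^ e.2.1 * cubicMixed k M ^ e.2.2

theorem mul_cubicNormalTwo_mem {M : ℕ} {g : MvPolynomial CubicVar k}
    (hg : g ∈ cubicGeneratorsTwo k M) (e : ℕ × ℕ × ℕ) :
    g * cubicNormalTwo k M e ∈ normalForms (Algebra.adjoin k (cubicGeneratorsTwo k M))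
      (MvPolynomial.X .x) (cubicNormalTwo k M) := by
  obtain ⟨i, j, l⟩ := e
  set S := Algebra.adjoin k (cubicGeneratorsTwo k M) with hS
  have hy : MvPolynomial.X .y ∈ S := Algebra.subset_adjoin (by simp [cubicGeneratorsTwo])
  have h2 : cubicQuad k M ∈ S := Algebra.subset_adjoin (by simp [cubicGeneratorsTwo])
  have h3 : cubicMixed k M ∈ S := Algebra.subset_adjoin (by simp [cubicGeneratorsTwo])
  have happ := apply_mem_normalForms S (MvPolynomial.X .x) (cubicNormalTwo k M)
  simp only [cubicGeneratorsTwo, Set.mem_insert_iff, Set.mem_singleton_iff] at hg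
  rcases hg with rfl | rfl | rfl | rfl
  · exact mul_mem_normalForms (S.mul_mem (S.mul_mem (S.pow_mem hy _) (S.pow_mem h2 _))
      (S.pow_mem h3 _))
  · convert happ ⟨i + 1, j, l⟩ using 1
    simp only [cubicNormalTwo]
    ring
  · convert happ ⟨i, j + 1, l⟩ using 1
    simp only [cubicNormalTwo]
    ring
  · convert happ ⟨i, j, l + 1⟩ using 1
    simp only [cubicNormalTwo]
    ring

/-- The specialization `x = 0`, `u = 0`. -/
noncomputable def cubicSpecializationTwo :
    MvPolynomial CubicVar k →ₐ[k] MvPolynomial CubicVar k :=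
  MvPolynomial.aeval fun
    | .x => 0
    | .u => 0
    | z => MvPolynomial.X z

theorem linearIndependent_cubicSpecializationTwo {M : ℕ} (hM : 0 < M) (h3 : (3 : k) ≠ 0) :
    LinearIndependent k fun e => cubicSpecializationTwo k (cubicNormalTwo k M e) := by
  have hX : ∀ z, cubicSpecializationTwo k (MvPolynomial.X z) = (match z with
    | .x => 0
    | .u => 0
    | z => MvPolynomial.X z) := fun z => by rw [cubicSpecializationTwo, MvPolynomial.aeval_X]
  have key : ∀ e : ℕ × ℕ × ℕ, cubicSpecializationTwo k (cubicNormalTwo k M e) =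
      MvPolynomial.monomial (Finsupp.single .y (e.1 + M * e.2.1 + M * e.2.2) +
        (Finsupp.single .s (2 * e.2.1 + e.2.2) + Finsupp.single .t e.2.2))
        ((-1) ^ e.2.1 * (-3) ^ e.2.2) := by
    intro e
    simp only [MvPolynomial.monomial_single_add, cubicNormalTwo, cubicQuad, cubicMixed,
      map_mul, map_pow, map_sub, hX, ← MvPolynomial.C_mul_X_pow_eq_monomial,
      zero_pow hM.ne', map_neg, map_one, map_ofNat]
    ring
  simp only [key]
  refine linearIndependent_monomial ?_ fun e => mul_ne_zero
    (pow_ne_zero _ (neg_ne_zero.mpr one_ne_zero)) (pow_ne_zero _ (neg_ne_zero.mpr h3))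
  intro e e' h
  have e1 := DFunLike.congr_fun h .y
  have e2 := DFunLike.congr_fun h .s
  have e3 := DFunLike.congr_fun h .t
  simp at e1 e2 e3
  obtain ⟨i, j, l⟩ := e
  obtain ⟨i', j', l'⟩ := e'
  simp only at e1 e2 e3
  subst e3
  obtain rfl : j = j' := by omega
  obtain rfl : i = i' := by omega
  rfl

/-- The fixed ring of the cubic is the algebra `S` generated by the elements of `G` as soon as they
are fixed, `f₂` and `f₃` belong to `S`, and `S` is saturated with respect to `x`. -/
theorem fixedRing_cubicImage_fg_of {M : ℕ} {G : Set (MvPolynomial CubicVar k)} (hfin : G.Finite)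
    (hx : MvPolynomial.X .x ∈ G) (hy : MvPolynomial.X .y ∈ G)
    (h2 : cubicQuad k M ∈ Algebra.adjoin k G) (h3 : cubicCub k M ∈ Algebra.adjoin k G)
    (hfix : ∀ g ∈ G, g ∈ fixedRing (MvPolynomial.aeval (cubicImage k M) :
      _ →ₐ[k] Polynomial (MvPolynomial CubicVar k)))
    (hsat : ∀ b, MvPolynomial.X .x * b ∈ Algebra.adjoin k G → b ∈ Algebra.adjoin k G) :
    (fixedRing (MvPolynomial.aeval (cubicImage k M) :
      _ →ₐ[k] Polynomial (MvPolynomial CubicVar k))).FG := by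
  have hge := Algebra.adjoin_le hfix
  set K := FractionRing (MvPolynomial CubicVar k)
  have hx0 : algebraMap _ K (MvPolynomial.X .x : MvPolynomial CubicVar k) ≠ 0 := by
    simp
  have hle := fixedRing_le_of_slice (f := cubicImage k M) (Algebra.subset_adjoin (R := k) hx)
    (-algebraMap (MvPolynomial CubicVar k) K (MvPolynomial.X .s) /
      algebraMap (MvPolynomial CubicVar k) K (MvPolynomial.X .x) ^ M)
    ?_ hsat
  · rw [le_antisymm hle hge]
    exact ⟨hfin.toFinset, by simp⟩
  · rintro (_ | _ | _ | _ | _)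
    · exact ⟨0, _, Algebra.subset_adjoin hx, by simp [cubicImage]⟩
    · exact ⟨0, _, Algebra.subset_adjoin hy, by simp [cubicImage]⟩
    · refine ⟨0, 0, Subalgebra.zero_mem _, ?_⟩
      simp only [cubicImage, map_add, map_mul, map_pow, Polynomial.aeval_C, Polynomial.aeval_X]
      field_simp
      rw [map_zero]
      ring
    · refine ⟨M, _, h2, ?_⟩
      simp only [cubicImage, cubicQuad, map_add, map_sub, map_mul, map_pow, Polynomial.aeval_C,
        Polynomial.aeval_X, map_ofNat]
      field_simp
      ring
    · refine ⟨2 * M, _, h3, ?_⟩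
      simp only [cubicImage, cubicCub, map_add, map_sub, map_mul, map_pow, Polynomial.aeval_C,
        Polynomial.aeval_X, map_ofNat, mul_comm 2 M, pow_mul]
      field_simp
      ring

theorem fixedRing_cubicImage_fg {M : ℕ} (hM : 0 < M) :
    (fixedRing (MvPolynomial.aeval (cubicImage k M) :
      _ →ₐ[k] Polynomial (MvPolynomial CubicVar k))).FG := by
  by_cases h2 : (2 : k) = 0
  · have h3 : (3 : k) ≠ 0 := by
      rw [show (3 : k) = 2 + 1 by norm_num, h2, zero_add]
      exact one_ne_zero
    have h2' : (2 : MvPolynomial CubicVar k) = 0 := by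
      rw [← map_ofNat (MvPolynomial.C (σ := CubicVar)) 2, h2, map_zero]
    have hcub : cubicCub k M = MvPolynomial.X .x ^ M * cubicMixed k M := by
      simp only [cubicCub, cubicMixed]
      linear_combination (MvPolynomial.X .y ^ (2 * M) * MvPolynomial.X .s ^ 3) * h2'
    refine fixedRing_cubicImage_fg_of k (G := cubicGeneratorsTwo k M)
      (by simp [cubicGeneratorsTwo]) (by simp [cubicGeneratorsTwo]) (by simp [cubicGeneratorsTwo])
      (Algebra.subset_adjoin (by simp [cubicGeneratorsTwo])) ?_ ?_ ?_
    · rw [hcub]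
      exact Subalgebra.mul_mem _
        (Subalgebra.pow_mem _ (Algebra.subset_adjoin (by simp [cubicGeneratorsTwo])) _)
        (Algebra.subset_adjoin (by simp [cubicGeneratorsTwo]))
    · intro g hg
      have h2'' : (2 : Polynomial (MvPolynomial CubicVar k)) = 0 := by
        rw [← map_ofNat Polynomial.C 2, h2', map_zero]
      simp only [cubicGeneratorsTwo, Set.mem_insert_iff, Set.mem_singleton_iff] at hg
      rw [mem_fixedRing]
      rcases hg with rfl | rfl | rfl | rfl <;>
        simp only [cubicQuad, cubicMixed, map_sub, map_mul, map_pow,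
          MvPolynomial.aeval_X, cubicImage, map_ofNat]
      · ring
      · linear_combination (-3 * Polynomial.C (MvPolynomial.X .y) ^ (2 * M) *
          Polynomial.C (MvPolynomial.X .s) ^ 2 * Polynomial.X -
          3 * Polynomial.C (MvPolynomial.X .x) ^ M * Polynomial.C (MvPolynomial.X .y) ^ (2 * M) *
          Polynomial.C (MvPolynomial.X .s) * Polynomial.X ^ 2 -
          Polynomial.C (MvPolynomial.X .x) ^ (2 * M) *
          Polynomial.C (MvPolynomial.X .y) ^ (2 * M) * Polynomial.X ^ 3) * h2''
    · intro b hb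
      refine mem_adjoin_of_mul_mem (MvPolynomial.X_ne_zero _) (cubicSpecializationTwo k) ?_
        (linearIndependent_cubicSpecializationTwo k hM h3) (i₀ := ⟨0, 0, 0⟩) ?_
        (fun g hg e => mul_cubicNormalTwo_mem k hg e) hb
      · simp [cubicSpecializationTwo]
      · simp [cubicNormalTwo]
  · refine fixedRing_cubicImage_fg_of k (G := cubicGenerators k M)
      (by simp [cubicGenerators]) (by simp [cubicGenerators]) (by simp [cubicGenerators])
      (Algebra.subset_adjoin (by simp [cubicGenerators]))
      (Algebra.subset_adjoin (by simp [cubicGenerators])) ?_ ?_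
    · intro g hg
      simp only [cubicGenerators, Set.mem_insert_iff, Set.mem_singleton_iff] at hg
      rw [mem_fixedRing]
      rcases hg with rfl | rfl | rfl | rfl | rfl <;>
        simp only [cubicQuad, cubicCub, cubicDisc, map_sub, map_add, map_mul, map_pow,
          MvPolynomial.aeval_X, cubicImage, map_ofNat] <;> ring
    · intro b hb
      refine mem_adjoin_of_mul_mem (MvPolynomial.X_ne_zero _) (cubicSpecialization k) ?_
        (linearIndependent_cubicSpecialization k hM h2) (i₀ := ⟨⟨0, 0, 0⟩, false⟩) ?_
        (fun g hg e => mul_cubicNormal_mem k hM hg e) hb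
      · simp [cubicSpecialization]
      · simp [cubicNormal]

end Cubic

/-! ### Monic invariants in positive characteristic -/

section Frobenius

variable {k A : Type*} [Field k] [CommRing A] [Algebra k A]

/-- `HasFrobeniusShift θ τ p` says that there are `a₁`, `a₀` for which `X ^ p - a₁ X - a₀` becomes
invariant if `θ` is extended to `A[X]` by `X ↦ X + τ U`: in characteristic `p`, the polynomial
`X ^ p - a₁ X` moves by `τ ^ p U ^ p - a₁ τ U`. -/
def HasFrobeniusShift (θ : A →ₐ[k] Polynomial A) (τ : A) (p : ℕ) : Prop :=
  ∃ a₁ a₀ : A, θ a₁ = Polynomial.C a₁ ∧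
    θ a₀ = Polynomial.C a₀ - Polynomial.C (a₁ * τ) * Polynomial.X +
      Polynomial.C (τ ^ p) * Polynomial.X ^ p

theorem fixedRing_fg_of_hasFrobeniusShift [Nontrivial A] {p : ℕ} [Fact p.Prime] [CharP A p]
    {θ₀ : A →ₐ[k] Polynomial A} (h0 : ∀ a, (θ₀ a).coeff 0 = a)
    {θ : Polynomial A →ₐ[k] Polynomial (Polynomial A)}
    (hθC : ∀ a, θ (Polynomial.C a) = (θ₀ a).map Polynomial.C) {τ : A}
    (hθX : θ Polynomial.X =
      Polynomial.C Polynomial.X + Polynomial.C (Polynomial.C τ) * Polynomial.X)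
    (hfg : (fixedRing θ₀).FG) (hτ : HasFrobeniusShift θ₀ τ p) : (fixedRing θ).FG := by
  obtain ⟨a₁, a₀, h1, h2⟩ := hτ
  have hp : 1 < p := (Fact.out : p.Prime).one_lt
  have hmon : (Polynomial.X ^ p - (Polynomial.C a₁ * Polynomial.X + Polynomial.C a₀)).Monic :=
    Polynomial.monic_X_pow_sub (Polynomial.degree_linear_le.trans_lt (by exact_mod_cast hp))
  refine Subalgebra.fg_of_monic (fixedRing θ) (fixedRing θ₀) hfg ?_
    (fun f hf => leadingCoeff_mem_fixedRing h0 hθC hθX hf) (F := Polynomial.X ^ p -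
      (Polynomial.C a₁ * Polynomial.X + Polynomial.C a₀)) ?_ hmon ?_
  · intro c hc
    rw [mem_fixedRing] at hc ⊢
    rw [hθC, hc, Polynomial.map_C]
  · rw [mem_fixedRing]
    simp only [map_sub, map_add, map_mul, map_pow, hθC, hθX, h1, h2, Polynomial.map_C,
      Polynomial.map_add, Polynomial.map_sub, Polynomial.map_mul, Polynomial.map_pow,
      Polynomial.map_X]
    rw [add_pow_char]
    ring
  · rw [Polynomial.natDegree_sub_eq_left_of_natDegree_lt, Polynomial.natDegree_X_pow]
    · omega
    · rw [Polynomial.natDegree_X_pow]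
      exact Polynomial.natDegree_linear_le.trans_lt hp

/-- If the coefficients of `g` move under `θ` like those of `g(Z + U)`, then the `n`-th coefficient
moves by multiples of the higher coefficients and binomial coefficients. -/
theorem apply_coeff_eq_sum {θ : A →ₐ[k] Polynomial A} {g : Polynomial A}
    (hg : g.map (θ : A →+* Polynomial A) =
      Polynomial.taylor Polynomial.X (g.map Polynomial.C)) {n K : ℕ} (hK0 : 0 < K)
    (hK : g.natDegree < n + K) :
    θ (g.coeff n) = ∑ j ∈ Finset.range K,
      ((j + n).choose n : Polynomial A) * Polynomial.C (g.coeff (j + n)) * Polynomial.X ^ j := by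
  have h := congrArg (fun q => q.coeff n) hg
  simp only [Polynomial.coeff_map, Polynomial.taylor_coeff] at h
  rw [show θ (g.coeff n) = (θ : A →+* Polynomial A) (g.coeff n) from rfl, h,
    Polynomial.eval_eq_sum_range' (n := K)]
  · simp [Polynomial.hasseDeriv_coeff]
  · refine (Polynomial.natDegree_hasseDeriv_le _ _).trans_lt ?_
    have := Polynomial.natDegree_map_le (f := (Polynomial.C : A →+* _)) (p := g)
    omega

theorem map_pow_eq_taylor {θ : A →ₐ[k] Polynomial A} {f : Polynomial A}
    (hf : f.map (θ : A →+* Polynomial A) =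
      Polynomial.taylor Polynomial.X (f.map Polynomial.C)) (N : ℕ) :
    (f ^ N).map (θ : A →+* Polynomial A) =
      Polynomial.taylor Polynomial.X ((f ^ N).map Polynomial.C) := by
  rw [Polynomial.map_pow, hf, Polynomial.map_pow, Polynomial.taylor_pow]

theorem Nat.Prime.eq_three_or_mod_three {p : ℕ} (hp : p.Prime) :
    p = 3 ∨ p % 3 = 1 ∨ p % 3 = 2 := by
  by_cases h3 : p = 3
  · exact Or.inl h3
  · have : ¬ 3 ∣ p := fun h => h3 ((Nat.prime_dvd_prime_iff_eq Nat.prime_three hp).mp h).symm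
    omega

theorem natCast_choose_eq {R : Type*} [CommRing R] {p : ℕ} [Fact p.Prime] [CharP R p] (n i : ℕ) :
    (n.choose i : R) = ((n % p).choose (i % p) * (n / p).choose (i / p) : ℕ) :=
  (CharP.natCast_eq_natCast R p).mpr Choose.choose_modEq_choose_mod_mul_choose_div_nat

variable {p : ℕ} [Fact p.Prime] [CharP A p] {θ : A →ₐ[k] Polynomial A} {f : Polynomial A}

/-- If `deg g ≤ 2p - 1`, then the coefficient `g_{p-1}` moves by `g_{2p-1} U ^ p`: the binomial
coefficients `(i choose p - 1)` with `p ≤ i ≤ 2p - 2` are divisible by `p`. -/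
theorem apply_coeff_pred {g : Polynomial A}
    (hg : g.map (θ : A →+* Polynomial A) =
      Polynomial.taylor Polynomial.X (g.map Polynomial.C)) (hdeg : g.natDegree ≤ 2 * p - 1) :
    θ (g.coeff (p - 1)) = Polynomial.C (g.coeff (p - 1)) +
      Polynomial.C (g.coeff (2 * p - 1)) * Polynomial.X ^ p := by
  have hp : 2 ≤ p := (Fact.out : p.Prime).two_le
  rw [apply_coeff_eq_sum hg p.succ_pos (by omega), Finset.sum_range_succ,
    Finset.sum_eq_single_of_mem 0 (Finset.mem_range.mpr (by omega))]
  · have h1 : (((p + (p - 1)).choose (p - 1) : ℕ) : Polynomial A) = 1 := by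
      rw [natCast_choose_eq (p := p), Nat.add_mod_left, Nat.mod_eq_of_lt (by omega : p - 1 < p),
        Nat.choose_self, Nat.div_eq_of_lt (by omega : p - 1 < p), Nat.choose_zero_right]
      simp
    rw [h1, show p + (p - 1) = 2 * p - 1 by omega]
    simp
  · intro j hj hj0
    rw [Finset.mem_range] at hj
    have h1 : (((j + (p - 1)).choose (p - 1) : ℕ) : Polynomial A) = 0 := by
      rw [natCast_choose_eq (p := p), show j + (p - 1) = p + (j - 1) by omega, Nat.add_mod_left,
        Nat.mod_eq_of_lt (by omega : p - 1 < p), Nat.mod_eq_of_lt (by omega : j - 1 < p),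
        Nat.choose_eq_zero_of_lt (by omega)]
      simp
    rw [h1, zero_mul, zero_mul]

/-- If `deg g ≤ 2p - 2`, then the coefficient `g_{p-2}` moves by
`-g_{p-1} U + g_{2p-2} U ^ p`. -/
theorem apply_coeff_pred_pred {g : Polynomial A}
    (hg : g.map (θ : A →+* Polynomial A) =
      Polynomial.taylor Polynomial.X (g.map Polynomial.C)) (hdeg : g.natDegree ≤ 2 * p - 2) :
    θ (g.coeff (p - 2)) = Polynomial.C (g.coeff (p - 2)) -
      Polynomial.C (g.coeff (p - 1)) * Polynomial.X +
      Polynomial.C (g.coeff (2 * p - 2)) * Polynomial.X ^ p := by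
  have hp : 2 ≤ p := (Fact.out : p.Prime).two_le
  rw [apply_coeff_eq_sum hg p.succ_pos (by omega), Finset.sum_range_succ,
    ← Finset.sum_subset (s₁ := {0, 1})]
  · have h1 : (((p + (p - 2)).choose (p - 2) : ℕ) : Polynomial A) = 1 := by
      rw [natCast_choose_eq (p := p), Nat.add_mod_left, Nat.mod_eq_of_lt (by omega : p - 2 < p),
        Nat.choose_self, Nat.div_eq_of_lt (by omega : p - 2 < p), Nat.choose_zero_right]
      simp
    have h2 : (((1 + (p - 2)).choose (p - 2) : ℕ) : Polynomial A) = -1 := by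
      rw [add_comm, Nat.choose_succ_self_right, eq_neg_iff_add_eq_zero, ← Nat.cast_succ,
        show (p - 2 + 1).succ = p by omega, CharP.cast_eq_zero]
    rw [Finset.sum_pair zero_ne_one, h1, h2, show p + (p - 2) = 2 * p - 2 by omega,
      show 1 + (p - 2) = p - 1 by omega]
    simp [sub_eq_add_neg]
  · intro j hj
    simp only [Finset.mem_insert, Finset.mem_singleton] at hj
    rw [Finset.mem_range]
    omega
  · intro j hj hj0
    simp only [Finset.mem_insert, Finset.mem_singleton] at hj0
    rw [Finset.mem_range] at hj
    have h1 : (((j + (p - 2)).choose (p - 2) : ℕ) : Polynomial A) = 0 := by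
      rw [natCast_choose_eq (p := p), show j + (p - 2) = p + (j - 2) by omega, Nat.add_mod_left,
        Nat.mod_eq_of_lt (by omega : p - 2 < p), Nat.mod_eq_of_lt (by omega : j - 2 < p),
        Nat.choose_eq_zero_of_lt (by omega)]
      simp
    rw [h1, zero_mul, zero_mul]

/-- Primes `p ≡ 2 mod 3`: with `N = (2p - 1) / 3`, the coefficient of `Z ^ (p - 1)` in the `N`-th
power of a cubic with leading coefficient `ℓ` moves by `ℓ ^ N U ^ p`. The factors `D` and `ε`
adjust `ℓ ^ N` to `τ ^ p`. -/
theorem hasFrobeniusShift_of_two_mod_three [IsDomain A]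
    (hf : f.map (θ : A →+* Polynomial A) =
      Polynomial.taylor Polynomial.X (f.map Polynomial.C)) (hdeg : f.natDegree ≤ 3)
    {N : ℕ} (hN : 3 * N + 1 = 2 * p) {D h ε τ : A} (hD0 : D ≠ 0) (hD : D ∈ fixedRing θ)
    (hε : ε ∈ fixedRing θ) (hh : D * h = (f ^ N).coeff (p - 1))
    (hℓ : ε * f.coeff 3 ^ N = D * τ ^ p) : HasFrobeniusShift θ τ p := by
  have hdegN : (f ^ N).natDegree ≤ 2 * p - 1 :=
    (Polynomial.natDegree_pow_le_of_le N hdeg).trans (by omega)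
  have h1 := apply_coeff_pred (p := p) (map_pow_eq_taylor hf N) hdegN
  have hlead : (f ^ N).coeff (2 * p - 1) = f.coeff 3 ^ N := by
    rw [show 2 * p - 1 = N * 3 by omega]
    exact Polynomial.coeff_pow_of_natDegree_le hdeg
  rw [mem_fixedRing] at hD hε
  rw [hlead, ← hh, map_mul, hD] at h1
  have hCℓ := congrArg Polynomial.C hℓ
  simp only [map_mul, map_pow] at h1 hCℓ
  refine ⟨0, ε * h, by simp, mul_left_cancel₀ (Polynomial.C_ne_zero.mpr hD0) ?_⟩
  simp only [map_mul, hε, map_pow, zero_mul, map_zero, sub_zero]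
  linear_combination Polynomial.C ε * h1 + Polynomial.X ^ p * hCℓ

/-- Primes `p ≡ 1 mod 3`: with `N = (2p - 2) / 3`, the coefficient of `Z ^ (p - 1)` in the `N`-th
power of a cubic with leading coefficient `ℓ` is invariant, and that of `Z ^ (p - 2)` has an
Artin-Schreier shift. -/
theorem hasFrobeniusShift_of_one_mod_three [IsDomain A]
    (hf : f.map (θ : A →+* Polynomial A) =
      Polynomial.taylor Polynomial.X (f.map Polynomial.C)) (hdeg : f.natDegree ≤ 3)
    {N : ℕ} (hN : 3 * N + 2 = 2 * p) {D h₁ h₂ ε τ : A} (hD0 : D ≠ 0) (hD : D ∈ fixedRing θ)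
    (hε : ε ∈ fixedRing θ) (hτ : τ ∈ fixedRing θ) (hh₁ : D * h₁ = (f ^ N).coeff (p - 1))
    (hh₂ : D * h₂ = (f ^ N).coeff (p - 2))
    (hℓ : ε * f.coeff 3 ^ N = D * τ ^ (p - 1)) : HasFrobeniusShift θ τ p := by
  have hp : 2 ≤ p := (Fact.out : p.Prime).two_le
  have hdegN : (f ^ N).natDegree ≤ 2 * p - 2 :=
    (Polynomial.natDegree_pow_le_of_le N hdeg).trans (by omega)
  have h1 := apply_coeff_pred (p := p) (map_pow_eq_taylor hf N) (hdegN.trans (by omega))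
  have h2 := apply_coeff_pred_pred (p := p) (map_pow_eq_taylor hf N) hdegN
  have hlead : (f ^ N).coeff (2 * p - 2) = f.coeff 3 ^ N := by
    rw [show 2 * p - 2 = N * 3 by omega]
    exact Polynomial.coeff_pow_of_natDegree_le hdeg
  rw [mem_fixedRing] at hD hε hτ
  rw [Polynomial.coeff_eq_zero_of_natDegree_lt (by omega : (f ^ N).natDegree < 2 * p - 1),
    ← hh₁, map_mul, hD, map_zero, zero_mul, add_zero, map_mul] at h1
  rw [hlead, ← hh₁, ← hh₂, map_mul, hD] at h2
  have hCℓ := congrArg Polynomial.C hℓ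
  simp only [map_mul, map_pow] at h2 hCℓ
  have hD0' : (Polynomial.C D : Polynomial A) ≠ 0 := Polynomial.C_ne_zero.mpr hD0
  refine ⟨ε * h₁, τ * (ε * h₂), ?_, mul_left_cancel₀ hD0' ?_⟩
  · rw [map_mul, hε, mul_left_cancel₀ hD0' h1, map_mul]
  · have hpow : (Polynomial.C τ : Polynomial A) ^ p =
        Polynomial.C τ * Polynomial.C τ ^ (p - 1) := by
      rw [← pow_succ', Nat.sub_add_cancel (by omega)]
    simp only [map_mul, hε, hτ, map_pow, hpow]
    linear_combination Polynomial.C τ * Polynomial.C ε * h2 +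
      Polynomial.C τ * Polynomial.X ^ p * hCℓ

end Frobenius

/-! ### Monic invariants for the pairs and for the cubic -/

section PairFrobenius

variable (k : Type*) [Field k]

theorem coeff_zero_aeval {V : Type*} {f : V → Polynomial (MvPolynomial V k)}
    (h : ∀ i, (f i).coeff 0 = MvPolynomial.X i) (a : MvPolynomial V k) :
    ((MvPolynomial.aeval f : _ →ₐ[k] Polynomial (MvPolynomial V k)) a).coeff 0 = a := by
  have h' : (Polynomial.constantCoeff : Polynomial (MvPolynomial V k) →+* _).comp
      ((MvPolynomial.aeval f : _ →ₐ[k] Polynomial (MvPolynomial V k)) : _ →+* _) =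
        RingHom.id _ := by
    apply MvPolynomial.ringHom_ext
    · intro r
      simp [Polynomial.algebraMap_apply]
    · intro i
      simp [h]
  exact RingHom.congr_fun h' a

/-- The product of the linear forms `(x i) ^ M * Z + y i`. -/
noncomputable def pairForm (M : ℕ) : Polynomial (MvPolynomial PairVar k) :=
  (Polynomial.C (MvPolynomial.X (.x 0) ^ M) * Polynomial.X +
      Polynomial.C (MvPolynomial.X (.y 0))) *
    (Polynomial.C (MvPolynomial.X (.x 1) ^ M) * Polynomial.X +
      Polynomial.C (MvPolynomial.X (.y 1))) *
    (Polynomial.C (MvPolynomial.X (.x 2) ^ M) * Polynomial.X +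
      Polynomial.C (MvPolynomial.X (.y 2)))

theorem pairForm_shift (M : ℕ) :
    (pairForm k M).map ((MvPolynomial.aeval (pairImage k M) :
      _ →ₐ[k] Polynomial (MvPolynomial PairVar k)) : _ →+* Polynomial (MvPolynomial PairVar k)) =
      Polynomial.taylor Polynomial.X ((pairForm k M).map Polynomial.C) := by
  simp only [pairForm, Polynomial.map_mul, Polynomial.map_add, Polynomial.map_C, Polynomial.map_X,
    Polynomial.map_pow, Polynomial.taylor_mul, Polynomial.taylor_pow, map_add, map_mul, map_pow,
    Polynomial.taylor_C, Polynomial.taylor_X, RingHom.coe_coe, MvPolynomial.aeval_X, pairImage]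
  ring

theorem natDegree_pairForm_le (M : ℕ) : (pairForm k M).natDegree ≤ 3 := by
  unfold pairForm
  compute_degree

theorem coeff_pairForm (M : ℕ) : (pairForm k M).coeff 3 =
    (MvPolynomial.X (.x 0) * MvPolynomial.X (.x 1) * MvPolynomial.X (.x 2)) ^ M := by
  unfold pairForm
  compute_degree
  · ring
  all_goals norm_num

theorem pairImage_hasFrobeniusShift (p : ℕ) [Fact p.Prime] [CharP k p] {m : ℕ} (hm : 2 ≤ m) :
    HasFrobeniusShift (MvPolynomial.aeval (pairImage k (m + 1)) :
      _ →ₐ[k] Polynomial (MvPolynomial PairVar k))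
      (MvPolynomial.X (.x 0) ^ m * MvPolynomial.X (.x 1) ^ m * MvPolynomial.X (.x 2) ^ m) p := by
  set θ : _ →ₐ[k] Polynomial (MvPolynomial PairVar k) :=
    MvPolynomial.aeval (pairImage k (m + 1)) with hθ
  set P : MvPolynomial PairVar k :=
    MvPolynomial.X (.x 0) * MvPolynomial.X (.x 1) * MvPolynomial.X (.x 2) with hP
  have hτ : MvPolynomial.X (.x 0) ^ m * MvPolynomial.X (.x 1) ^ m *
      MvPolynomial.X (.x 2) ^ m = P ^ m := by
    rw [hP, mul_pow, mul_pow]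
  have hPfix : P ∈ fixedRing θ := by
    rw [mem_fixedRing, hP, hθ]
    simp [pairImage]
  have hfac : Nat.Prime p := Fact.out
  rw [hτ]
  rcases hfac.eq_three_or_mod_three with rfl | h1 | h2
  · -- With `z i = y i / (x i) ^ (m + 1)`, this is `(x₁ x₂ x₃) ^ (3 m)` times the polynomial
    -- `z₁ ^ 3 + (z₂ - z₁) ^ 2 * (z₃ - z₁)`, in which `z₁ ^ 3` cancels.
    obtain ⟨n, rfl⟩ : ∃ n, m = n + 2 := ⟨m - 2, by omega⟩
    have h3 : (3 : Polynomial (MvPolynomial PairVar k)) = 0 := by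
      exact_mod_cast CharP.cast_eq_zero (Polynomial (MvPolynomial PairVar k)) 3
    let x : Fin 3 → MvPolynomial PairVar k := fun i => MvPolynomial.X (.x i)
    let y : Fin 3 → MvPolynomial PairVar k := fun i => MvPolynomial.X (.y i)
    refine ⟨0, x 0 ^ (3 * n + 6) * x 1 ^ n * x 2 ^ (2 * n + 3) * y 1 ^ 2 * y 2 -
      x 0 ^ (2 * n + 3) * x 1 ^ n * x 2 ^ (3 * n + 6) * y 0 * y 1 ^ 2 -
      2 * x 0 ^ (2 * n + 3) * x 1 ^ (2 * n + 3) * x 2 ^ (2 * n + 3) * y 0 * y 1 * y 2 +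
      2 * x 0 ^ n * x 1 ^ (2 * n + 3) * x 2 ^ (3 * n + 6) * y 0 ^ 2 * y 1 +
      x 0 ^ n * x 1 ^ (3 * n + 6) * x 2 ^ (2 * n + 3) * y 0 ^ 2 * y 2, by simp, ?_⟩
    simp only [x, y, hP, hθ, map_add, map_sub, map_mul, map_pow, map_ofNat, map_zero,
      MvPolynomial.aeval_X, pairImage]
    linear_combination (Polynomial.C (MvPolynomial.X (.x 0)) ^ n *
      Polynomial.C (MvPolynomial.X (.x 1)) ^ (3 * n + 6) *
      Polynomial.C (MvPolynomial.X (.x 2)) ^ (3 * n + 6) *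
      Polynomial.C (MvPolynomial.X (.y 0)) ^ 2 * Polynomial.X +
      Polynomial.C (MvPolynomial.X (.x 0)) ^ (2 * n + 3) *
      Polynomial.C (MvPolynomial.X (.x 1)) ^ (3 * n + 6) *
      Polynomial.C (MvPolynomial.X (.x 2)) ^ (3 * n + 6) *
      Polynomial.C (MvPolynomial.X (.y 0)) * Polynomial.X ^ 2) * h3
  · obtain ⟨r, rfl⟩ : ∃ r, p = 3 * r + 1 := ⟨p / 3, by omega⟩
    have hr : 0 < r := by
      rcases Nat.eq_zero_or_pos r with rfl | h
      · exact absurd hfac (by norm_num)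
      · exact h
    have hle : (m + 1) * (2 * r) ≤ m * (3 * r) := by nlinarith
    refine hasFrobeniusShift_of_one_mod_three (pairForm_shift k _) (natDegree_pairForm_le k _)
      (N := 2 * r) (by omega) (D := 1) (ε := P ^ (m * (3 * r) - (m + 1) * (2 * r))) one_ne_zero
      (Subalgebra.one_mem _) (Subalgebra.pow_mem _ hPfix _) (Subalgebra.pow_mem _ hPfix _)
      (one_mul _) (one_mul _) ?_
    rw [coeff_pairForm, ← hP, ← pow_mul, ← pow_add, Nat.sub_add_cancel hle, one_mul, ← pow_mul,
      Nat.add_sub_cancel]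
  · obtain ⟨r, rfl⟩ : ∃ r, p = 3 * r + 2 := ⟨p / 3, by omega⟩
    have hle : (m + 1) * (2 * r + 1) ≤ m * (3 * r + 2) := by nlinarith
    refine hasFrobeniusShift_of_two_mod_three (pairForm_shift k _) (natDegree_pairForm_le k _)
      (N := 2 * r + 1) (by omega) (D := 1)
      (ε := P ^ (m * (3 * r + 2) - (m + 1) * (2 * r + 1))) one_ne_zero
      (Subalgebra.one_mem _) (Subalgebra.pow_mem _ hPfix _) (one_mul _) ?_
    rw [coeff_pairForm, ← hP, ← pow_mul, ← pow_add, Nat.sub_add_cancel hle, one_mul, ← pow_mul]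

end PairFrobenius

section CubicFrobenius

/-- The condition that `Y ^ ⌈2 i / 3⌉` divides the `i`-th coefficient is multiplicative. -/
theorem pow_dvd_coeff_pow {A : Type*} [CommRing A] {Y : A} {f : Polynomial A}
    (hf : ∀ i, Y ^ ((2 * i + 2) / 3) ∣ f.coeff i) (N i : ℕ) :
    Y ^ ((2 * i + 2) / 3) ∣ (f ^ N).coeff i := by
  induction N generalizing i with
  | zero =>
    rw [pow_zero, Polynomial.coeff_one]
    split_ifs with h
    · simp [h]
    · exact dvd_zero _
  | succ N ih =>
    rw [pow_succ, Polynomial.coeff_mul]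
    refine Finset.dvd_sum fun ij hij => ?_
    have hsum : ij.1 + ij.2 = i :=
      Finset.HasAntidiagonal.mem_antidiagonal.mp hij
    refine (pow_dvd_pow Y ?_).trans ((pow_add Y _ _).dvd.trans (mul_dvd_mul (ih ij.1) (hf ij.2)))
    omega

variable (k : Type*) [Field k]

/-- The cubic whose coefficients `cubicImage` shifts. -/
noncomputable def cubicForm (M : ℕ) : Polynomial (MvPolynomial CubicVar k) :=
  let x : MvPolynomial CubicVar k := MvPolynomial.X .x
  let y : MvPolynomial CubicVar k := MvPolynomial.X .y
  let s : MvPolynomial CubicVar k := MvPolynomial.X .s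
  let t : MvPolynomial CubicVar k := MvPolynomial.X .t
  let u : MvPolynomial CubicVar k := MvPolynomial.X .u
  let Z : Polynomial (MvPolynomial CubicVar k) := Polynomial.X
  Polynomial.C (x ^ M * (y ^ M) ^ 2) * Z ^ 3 + Polynomial.C (3 * (y ^ M) ^ 2 * s) * Z ^ 2 +
    Polynomial.C (3 * y ^ M * t) * Z + Polynomial.C u

theorem cubicForm_shift (M : ℕ) :
    (cubicForm k M).map ((MvPolynomial.aeval (cubicImage k M) :
      _ →ₐ[k] Polynomial (MvPolynomial CubicVar k)) : _ →+* Polynomial (MvPolynomial CubicVar k)) =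
      Polynomial.taylor Polynomial.X ((cubicForm k M).map Polynomial.C) := by
  have h3 : Polynomial.taylor (Polynomial.X : Polynomial (MvPolynomial CubicVar k))
      (3 : Polynomial (Polynomial (MvPolynomial CubicVar k))) = 3 := by
    rw [← map_ofNat Polynomial.C 3, Polynomial.taylor_C]
  simp only [cubicForm, Polynomial.map_mul, Polynomial.map_add, Polynomial.map_C, Polynomial.map_X,
    Polynomial.map_pow, Polynomial.taylor_mul, Polynomial.taylor_pow, map_add, map_mul, map_pow,
    Polynomial.taylor_C, Polynomial.taylor_X, RingHom.coe_coe, MvPolynomial.aeval_X, cubicImage,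
    map_ofNat, Polynomial.map_ofNat, h3]
  ring

theorem natDegree_cubicForm_le (M : ℕ) : (cubicForm k M).natDegree ≤ 3 := by
  dsimp only [cubicForm]
  compute_degree

theorem coeff_cubicForm (M : ℕ) : (cubicForm k M).coeff 3 =
    MvPolynomial.X .x ^ M * (MvPolynomial.X .y ^ M) ^ 2 := by
  simp only [cubicForm, Polynomial.coeff_add, Polynomial.coeff_C_mul,
    Polynomial.coeff_X_pow, Polynomial.coeff_X, Polynomial.coeff_C]
  norm_num

theorem pow_dvd_coeff_cubicForm (M i : ℕ) :
    (MvPolynomial.X .y ^ M) ^ ((2 * i + 2) / 3) ∣ (cubicForm k M).coeff i := by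
  rcases Nat.lt_or_ge 3 i with hi | hi
  · rw [Polynomial.coeff_eq_zero_of_natDegree_lt ((natDegree_cubicForm_le k M).trans_lt hi)]
    exact dvd_zero _
  · interval_cases i
    · simp
    · refine Dvd.intro (3 * MvPolynomial.X .t) ?_
      simp only [cubicForm, Polynomial.coeff_add, Polynomial.coeff_C_mul,
        Polynomial.coeff_X_pow, Polynomial.coeff_X, Polynomial.coeff_C]
      norm_num
      ring
    · refine Dvd.intro (3 * MvPolynomial.X .s) ?_
      simp only [cubicForm, Polynomial.coeff_add, Polynomial.coeff_C_mul,
        Polynomial.coeff_X_pow, Polynomial.coeff_X, Polynomial.coeff_C]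
      norm_num
      ring
    · rw [coeff_cubicForm]
      exact Dvd.intro_left _ rfl

theorem cubicImage_hasFrobeniusShift (p : ℕ) [Fact p.Prime] [CharP k p] {m : ℕ} (hm : 2 ≤ m) :
    HasFrobeniusShift (MvPolynomial.aeval (cubicImage k (m + 1)) :
      _ →ₐ[k] Polynomial (MvPolynomial CubicVar k))
      (MvPolynomial.X .x ^ m * MvPolynomial.X .y ^ m) p := by
  set θ : _ →ₐ[k] Polynomial (MvPolynomial CubicVar k) :=
    MvPolynomial.aeval (cubicImage k (m + 1)) with hθ
  have hx : MvPolynomial.X .x ∈ fixedRing θ := by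
    rw [mem_fixedRing, hθ]
    simp [cubicImage]
  have hy : MvPolynomial.X .y ∈ fixedRing θ := by
    rw [mem_fixedRing, hθ]
    simp [cubicImage]
  have hy0 : (MvPolynomial.X .y : MvPolynomial CubicVar k) ≠ 0 := MvPolynomial.X_ne_zero _
  have hfac : Nat.Prime p := Fact.out
  have hdvd := pow_dvd_coeff_pow (pow_dvd_coeff_cubicForm k (m + 1))
  -- The power of `x * y` by which `τ ^ e * D` exceeds `ℓ ^ N` if `D = y ^ ((m + 1) * N)`.
  have hexp : ∀ {N e : ℕ}, (m + 1) * N ≤ m * e →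
      (MvPolynomial.X .x * MvPolynomial.X .y : MvPolynomial CubicVar k) ^ (m * e - (m + 1) * N) *
        (MvPolynomial.X .x ^ (m + 1) * (MvPolynomial.X .y ^ (m + 1)) ^ 2) ^ N =
      (MvPolynomial.X .y ^ (m + 1)) ^ N * (MvPolynomial.X .x ^ m * MvPolynomial.X .y ^ m) ^ e := by
    intro N e h
    obtain ⟨d, hd⟩ := Nat.exists_eq_add_of_le h
    rw [← mul_pow _ _ m, ← pow_mul _ m e, hd, Nat.add_sub_cancel_left]
    ring
  rcases hfac.eq_three_or_mod_three with rfl | h1 | h2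
  · obtain ⟨n, rfl⟩ : ∃ n, m = n + 2 := ⟨m - 2, by omega⟩
    have h3 : (3 : Polynomial (MvPolynomial CubicVar k)) = 0 := by
      exact_mod_cast CharP.cast_eq_zero (Polynomial (MvPolynomial CubicVar k)) 3
    refine ⟨0, MvPolynomial.X .x ^ (2 * n + 3) * MvPolynomial.X .y ^ n * MvPolynomial.X .u,
      by simp, ?_⟩
    simp only [hθ, map_mul, map_pow, map_ofNat, map_zero, MvPolynomial.aeval_X, cubicImage]
    linear_combination (Polynomial.C (MvPolynomial.X .x) ^ (2 * n + 3) *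
      Polynomial.C (MvPolynomial.X .y) ^ n * (Polynomial.C (MvPolynomial.X .y) ^ (n + 3) *
      Polynomial.C (MvPolynomial.X .t) * Polynomial.X +
      Polynomial.C (MvPolynomial.X .y) ^ (2 * n + 6) * Polynomial.C (MvPolynomial.X .s) *
      Polynomial.X ^ 2)) * h3
  · obtain ⟨r, rfl⟩ : ∃ r, p = 3 * r + 1 := ⟨p / 3, by omega⟩
    have hr : 0 < r := by
      rcases Nat.eq_zero_or_pos r with rfl | h
      · exact absurd hfac (by norm_num)
      · exact h
    have hle : (m + 1) * (2 * r) ≤ m * (3 * r) := by nlinarith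
    obtain ⟨h₁, hh₁⟩ := hdvd (2 * r) (3 * r + 1 - 1)
    obtain ⟨h₂, hh₂⟩ := hdvd (2 * r) (3 * r + 1 - 2)
    rw [show (2 * (3 * r + 1 - 1) + 2) / 3 = 2 * r by omega] at hh₁
    rw [show (2 * (3 * r + 1 - 2) + 2) / 3 = 2 * r by omega] at hh₂
    refine hasFrobeniusShift_of_one_mod_three (cubicForm_shift k _) (natDegree_cubicForm_le k _)
      (N := 2 * r) (by omega) (pow_ne_zero _ (pow_ne_zero _ hy0))
      (Subalgebra.pow_mem _ (Subalgebra.pow_mem _ hy _) _)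
      (Subalgebra.pow_mem _ (Subalgebra.mul_mem _ hx hy) (m * (3 * r) - (m + 1) * (2 * r)))
      (Subalgebra.mul_mem _ (Subalgebra.pow_mem _ hx _) (Subalgebra.pow_mem _ hy _))
      hh₁.symm hh₂.symm ?_
    rw [coeff_cubicForm, hexp hle, Nat.add_sub_cancel]
  · obtain ⟨r, rfl⟩ : ∃ r, p = 3 * r + 2 := ⟨p / 3, by omega⟩
    have hle : (m + 1) * (2 * r + 1) ≤ m * (3 * r + 2) := by nlinarith
    obtain ⟨h, hh⟩ := hdvd (2 * r + 1) (3 * r + 2 - 1)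
    rw [show (2 * (3 * r + 2 - 1) + 2) / 3 = 2 * r + 1 by omega] at hh
    refine hasFrobeniusShift_of_two_mod_three (cubicForm_shift k _) (natDegree_cubicForm_le k _)
      (N := 2 * r + 1) (by omega) (pow_ne_zero _ (pow_ne_zero _ hy0))
      (Subalgebra.pow_mem _ (Subalgebra.pow_mem _ hy _) _)
      (Subalgebra.pow_mem _ (Subalgebra.mul_mem _ hx hy)
        (m * (3 * r + 2) - (m + 1) * (2 * r + 1))) hh.symm ?_
    rw [coeff_cubicForm, hexp hle]

end CubicFrobenius

/-! ### Adjoining the variable `v` -/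

section Adjoin

variable {k : Type*} [Field k]

/-- The extension of `θ` to `A[X]` by `X ↦ X + τ U`. -/
noncomputable def extendShift {A : Type*} [CommRing A] [Algebra k A] (θ : A →ₐ[k] Polynomial A)
    (τ : A) : Polynomial A →ₐ[k] Polynomial (Polynomial A) :=
  Polynomial.eval₂AlgHom ((Polynomial.mapAlgHom Polynomial.CAlgHom).comp θ)
    (Polynomial.C Polynomial.X + Polynomial.C (Polynomial.C τ) * Polynomial.X)
    fun _ => Commute.all _ _

theorem extendShift_C {A : Type*} [CommRing A] [Algebra k A] (θ : A →ₐ[k] Polynomial A)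
    (τ a : A) : extendShift θ τ (Polynomial.C a) = (θ a).map Polynomial.C := by
  simp only [extendShift, Polynomial.eval₂AlgHom_apply, Polynomial.eval₂_C]
  rfl

theorem extendShift_X {A : Type*} [CommRing A] [Algebra k A] (θ : A →ₐ[k] Polynomial A)
    (τ : A) : extendShift θ τ Polynomial.X =
      Polynomial.C Polynomial.X + Polynomial.C (Polynomial.C τ) * Polynomial.X := by
  simp only [extendShift, Polynomial.eval₂AlgHom_apply, Polynomial.eval₂_X]

/-- Finite generation passes from the variables `V` to the variables `W`, which consist of `V` and
one further variable that moves by `τ U`, in the presence of a monic invariant. -/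
theorem fixedRing_fg_of_option {V W : Type*} (q : Option V ≃ W) (p : ℕ) [Fact p.Prime] [CharP k p]
    {f₀ : V → Polynomial (MvPolynomial V k)} {f : W → Polynomial (MvPolynomial W k)}
    {τ : MvPolynomial V k} (h0 : ∀ i, (f₀ i).coeff 0 = MvPolynomial.X i)
    (hsome : ∀ i, f (q (some i)) =
      Polynomial.mapAlgHom (MvPolynomial.rename fun j => q (some j)) (f₀ i))
    (hnone : f (q none) = Polynomial.C (MvPolynomial.X (q none)) +
      Polynomial.C (MvPolynomial.rename (fun j => q (some j)) τ) * Polynomial.X)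
    (hfg : (fixedRing (MvPolynomial.aeval f₀ : _ →ₐ[k] Polynomial (MvPolynomial V k))).FG)
    (hτ : HasFrobeniusShift (MvPolynomial.aeval f₀ : _ →ₐ[k] Polynomial (MvPolynomial V k)) τ p) :
    (fixedRing (MvPolynomial.aeval f : _ →ₐ[k] Polynomial (MvPolynomial W k))).FG := by
  set θ₀ : MvPolynomial V k →ₐ[k] Polynomial (MvPolynomial V k) := MvPolynomial.aeval f₀ with hθ₀
  set ι : MvPolynomial V k →ₐ[k] MvPolynomial W k :=
    MvPolynomial.rename fun j => q (some j) with hι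
  let e : Polynomial (MvPolynomial V k) →ₐ[k] MvPolynomial W k :=
    Polynomial.eval₂AlgHom ι (MvPolynomial.X (q none)) fun _ => Commute.all _ _
  have heC : ∀ a, e (Polynomial.C a) = ι a := fun a => by
    simp only [e, Polynomial.eval₂AlgHom_apply, Polynomial.eval₂_C]
    rfl
  have heX : e Polynomial.X = MvPolynomial.X (q none) := by
    simp only [e, Polynomial.eval₂AlgHom_apply, Polynomial.eval₂_X]
  let jv : Option V → Polynomial (MvPolynomial V k)
    | none => Polynomial.X
    | some i => Polynomial.C (MvPolynomial.X i)
  let j : MvPolynomial W k →ₐ[k] Polynomial (MvPolynomial V k) :=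
    MvPolynomial.aeval fun w => jv (q.symm w)
  have hjn : j (MvPolynomial.X (q none)) = Polynomial.X := by simp [j, jv]
  have hjs : ∀ i, j (MvPolynomial.X (q (some i))) = Polynomial.C (MvPolynomial.X i) := fun i => by
    simp [j, jv]
  have hjι : j.comp ι = Polynomial.CAlgHom := by
    apply MvPolynomial.algHom_ext
    intro i
    rw [AlgHom.comp_apply, hι, MvPolynomial.rename_X, hjs]
    rfl
  refine fixedRing_fg_of_retract (θ := extendShift θ₀ τ) e ?_ j ?_ ?_
    (fixedRing_fg_of_hasFrobeniusShift (p := p) (coeff_zero_aeval k h0) (extendShift_C θ₀ τ)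
      (extendShift_X θ₀ τ) hfg hτ)
  · apply Polynomial.algHom_ext'
    · apply MvPolynomial.algHom_ext
      intro i
      have h1 : e.comp Polynomial.CAlgHom = ι := AlgHom.ext heC
      have h2 : Polynomial.mapAlgHom e (Polynomial.map Polynomial.C (f₀ i)) =
          Polynomial.mapAlgHom (e.comp Polynomial.CAlgHom) (f₀ i) := by
        simp only [Polynomial.coe_mapAlgHom, Polynomial.map_map]
        rfl
      simp only [AlgHom.comp_apply, Polynomial.CAlgHom_apply, heC, extendShift_C]
      rw [hι, MvPolynomial.rename_X, MvPolynomial.aeval_X, hθ₀, MvPolynomial.aeval_X, h2, h1,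
        hsome]
    · simp only [AlgHom.comp_apply, heX, extendShift_X, MvPolynomial.aeval_X, hnone, map_add,
        map_mul, Polynomial.coe_mapAlgHom, Polynomial.map_C, Polynomial.map_X, RingHom.coe_coe,
        heC]
  · apply MvPolynomial.algHom_ext
    intro w
    obtain ⟨o, rfl⟩ := q.surjective w
    rcases o with _ | i
    · have h1 : j (ι τ) = Polynomial.C τ := AlgHom.congr_fun hjι τ
      simp only [AlgHom.comp_apply, hjn, extendShift_X, MvPolynomial.aeval_X, hnone, map_add,
        map_mul, Polynomial.coe_mapAlgHom, Polynomial.map_C, Polynomial.map_X, RingHom.coe_coe,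
        h1]
    · have h2 : Polynomial.mapAlgHom j (Polynomial.mapAlgHom ι (f₀ i)) =
          Polynomial.mapAlgHom (j.comp ι) (f₀ i) := by
        simp only [Polynomial.coe_mapAlgHom, Polynomial.map_map]
        rfl
      simp only [AlgHom.comp_apply, hjs, extendShift_C, MvPolynomial.aeval_X, hsome]
      rw [h2, hjι, hθ₀, MvPolynomial.aeval_X]
      rfl
  · intro b
    have : e.comp j = AlgHom.id k _ := by
      apply MvPolynomial.algHom_ext
      intro w
      obtain ⟨o, rfl⟩ := q.surjective w
      rcases o with _ | i
      · rw [AlgHom.comp_apply, hjn, heX, AlgHom.id_apply]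
      · rw [AlgHom.comp_apply, hjs, heC, hι, MvPolynomial.rename_X, AlgHom.id_apply]
    exact AlgHom.congr_fun this b

end Adjoin

/-! ### The three examples -/

section Examples

variable (k : Type*) [Field k] {m : ℕ}

/-- The variables of `B₆` are those of the cubic and `v`. -/
def cubicEquiv : Option CubicVar ≃ Var6 where
  toFun
    | none => .v
    | some .x => .x
    | some .y => .y
    | some .s => .s
    | some .t => .t
    | some .u => .u
  invFun
    | .v => none
    | .x => some .x
    | .y => some .y
    | .s => some .s
    | .t => some .t
    | .u => some .u
  left_inv := by rintro (_ | _ | _ | _ | _ | _) <;> rfl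
  right_inv := by rintro (_ | _ | _ | _ | _ | _) <;> rfl

/-- The variables of `B₇` are the three pairs and `v`. -/
def pairEquiv : Option PairVar ≃ Var7 where
  toFun
    | none => .v
    | some (.x i) => .x i
    | some (.y i) => .y i
  invFun
    | .v => none
    | .x i => some (.x i)
    | .y i => some (.y i)
  left_inv := by rintro (_ | _ | _) <;> rfl
  right_inv := by rintro (_ | _ | _) <;> rfl

theorem invariants_F6_fg (p : ℕ) [Fact p.Prime] [CharP k p] (hm : 2 ≤ m) : (F6 k m).invariants.FG := by
  rw [LFIHD.invariants_eq_fixedRing]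
  refine fixedRing_fg_of_option cubicEquiv p (f := fImage k m) ?_ ?_ ?_
    (fixedRing_cubicImage_fg k m.succ_pos) (cubicImage_hasFrobeniusShift k p hm)
  · rintro (_ | _ | _ | _ | _) <;> simp [cubicImage, Polynomial.coeff_X_pow, Polynomial.coeff_C]
  · rintro (_ | _ | _ | _ | _) <;> simp [cubicImage, fImage, cubicEquiv, map_ofNat]
  · simp [fImage, cubicEquiv]

theorem invariants_R7_fg (p : ℕ) [Fact p.Prime] [CharP k p] (hm : 2 ≤ m) : (R7 k m).invariants.FG := by
  rw [LFIHD.invariants_eq_fixedRing]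
  refine fixedRing_fg_of_option pairEquiv p (f := rImage k m) ?_ ?_ ?_
    (fixedRing_pairImage_fg k m.succ_pos) (pairImage_hasFrobeniusShift k p hm)
  · rintro (_ | _) <;> simp [pairImage]
  · rintro (_ | _) <;> simp [pairImage, rImage, pairEquiv]
  · simp [rImage, pairEquiv]

/-- The specialization `y = 1` is equivariant from `B₆` to `B₅`, and weighting the variables of
`B₅` by powers of `y` gives an equivariant section. -/
theorem invariants_DF5_fg (p : ℕ) [Fact p.Prime] [CharP k p] (hm : 2 ≤ m) : (DF5 k m).invariants.FG := by
  have h6 := invariants_F6_fg k p hm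
  rw [LFIHD.invariants_eq_fixedRing] at h6 ⊢
  let πv : Var6 → MvPolynomial Var5 k
    | .x => MvPolynomial.X .x
    | .y => 1
    | .s => MvPolynomial.X .s
    | .t => MvPolynomial.X .t
    | .u => MvPolynomial.X .u
    | .v => MvPolynomial.X .v
  let y : MvPolynomial Var6 k := MvPolynomial.X .y
  let jv : Var5 → MvPolynomial Var6 k
    | .x => MvPolynomial.X .x * y ^ 2
    | .s => y ^ (2 * (m + 1)) * MvPolynomial.X .s
    | .t => y ^ (m + 1) * MvPolynomial.X .t
    | .u => MvPolynomial.X .u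
    | .v => y ^ m * MvPolynomial.X .v
  have h6v : ∀ w, (F6 k m).toAlgHom (MvPolynomial.X w) = fImage k m w := fun w =>
    MvPolynomial.aeval_X _ w
  have h5v : ∀ w, (DF5 k m).toAlgHom (MvPolynomial.X w) = dfImage k m w := fun w =>
    MvPolynomial.aeval_X _ w
  refine fixedRing_fg_of_retract (MvPolynomial.aeval πv) ?_ (MvPolynomial.aeval jv) ?_ ?_ h6
  · apply MvPolynomial.algHom_ext
    rintro (_ | _ | _ | _ | _ | _) <;>
      simp [h6v, h5v, fImage, dfImage, πv, map_ofNat]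
  · apply MvPolynomial.algHom_ext
    rintro (_ | _ | _ | _ | _) <;>
      simp [h6v, h5v, fImage, dfImage, jv, y, map_ofNat] <;> ring
  · intro b
    have : (MvPolynomial.aeval πv : _ →ₐ[k] MvPolynomial Var5 k).comp (MvPolynomial.aeval jv) =
        AlgHom.id k _ := by
      apply MvPolynomial.algHom_ext
      rintro (_ | _ | _ | _ | _) <;> simp [jv, πv, y]
    exact AlgHom.congr_fun this b

end Examples

theorem theorem5p3 (k : Type*) [Field k] (p : ℕ) [CharP k p] (hp : 0 < p)
    (m : ℕ) (hm : 2 ≤ m) :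
    (DF5 k m).invariants.FG ∧ (F6 k m).invariants.FG ∧ (R7 k m).invariants.FG := by
  have : Fact p.Prime := ⟨(CharP.char_is_prime_or_zero k p).resolve_right hp.ne'⟩
  exact ⟨invariants_DF5_fg k p hm, invariants_F6_fg k p hm, invariants_R7_fg k p hm⟩
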